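/- **Setting.** Let $n\ge 1$, let $N=2^m$ with $m=\log_2 N\ge 1$, and let $$H=\sum_{j=1}^{n-1}\big(a^x_jX_jX_{j+1}+a^y_jY_jY_{j+1}\big)+\sum_{j=1}^n a^z_jZ_j$$ be an $XY$ Hamiltonian on $n$ qubits with real coefficients; put $U(t)=e^{-iHt}$ and $\varepsilon=T/N$ with $T\in\mathbb R$. Consider the ansatz $$W(\alpha)=\prod_{l=1}^{L}\Big(\prod_{j=1}^{n-1}e^{i\alpha_{j,l}X_jY_{j+1}}\prod_{j=1}^{n-1}e^{i\alpha'_{j,l}Y_jX_{j+1}}\Big),\qquad D(\beta)=\sum_{j=1}^n\beta_jZ_j ,$$ where the products over $j$ are taken in one fixed order (for instance $j=1,\dots,n-1$, or the brick-wall order). The parameters are called *trained* if the cost $C=2^{-n}\|H-W(\alpha)D(\beta)W(\alpha)^\dagger\|_{HS}^2$ takes its optimal value $0$. A circuit is a sequence of gates; its depth is the number of time steps when gates on disjoint sets of qubits run in parallel; an elementary circuit consists of one- and two-qubit unitary gates. The history state subroutine applies a Hadamard gate to each of the $m$ clock qubits and then, for $j=1,\dots,m$, the gate $U(2^{j-1}\varepsilon)$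 on the system controlled by clock qubit $j$. In its diagonalized form these controlled gates are replaced by $W(\alpha)^\dagger$ on the system, the controlled one-qubit rotations $e^{-i\beta_k2^{j-1}\varepsilon Z_k}$ (clock qubit $j$, system qubit $k$), and $W(\alpha)$ on the system, where $W(\alpha)^{\dagger}$ and $W(\alpha)$ are applied by the two-qubit gates in the product above. The parallel-in-time circuits are: 1. *($\widetilde F(O_1,O_2,\omega)=\frac1N\sum_{t=0}^{N-1} e^{-i\omega\varepsilon t}\langle U(\varepsilon t)^\dagger O_1U(\varepsilon t)O_2\rangle$, with Pauli operators $O_1,O_2$ and $\omega\in\mathbb R$)* Hadamard gates on the clock and on one ancilla, optionally $S^\dagger$ on the ancilla (for the imaginary part), $O_2$ controlled by the ancilla, the controlled evolutions, $O_1$ controlled by the ancilla, the phases $e^{-i\omega\varepsilon2^{j-1}}$ on the ancilla controlled by clock qubit $j$, and a Hadamard gate on the ancilla; 2. *(Loschmidt echo $\widetilde{\mathcal L}(\psi_0)=\frac1N\sum_{t=0}^{N-1}|\langle\psi_0|U(\varepsilon t)|\psi_0\rangle|^2$)* the history state subroutine, then the state-overlap circuit (a CNOT and a Hadamard gate for each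 pair of qubits) between the system and a second copy of $|\psi_0\rangle$; 3. *(linear entropy $E_2=1-\mathrm{Tr}\,\rho_T^2$ by state overlap)* two copies of the history state subroutine, then the state-overlap circuit between the two clocks; 4. *($E_2$ by randomized measurements)* the history state subroutine, then an arbitrary (drawn) one-qubit unitary on each clock qubit. **Theorem.** (a) For every such $H$ and every $L\ge n$ there are trained parameters for the ansatz with $L$ layers (products over $j$ in the order $1,\dots,n-1$). (b) For every constant $c$ there is a constant $K$, depending on $c$ only, such that for all $n,m\ge1$, all $XY$ Hamiltonians $H$, all $T$, all $L\le cn$, every order of the products over $j$, and all trained parameters: replacing the history state subroutine by its diagonalized form (and writing the controlled Pauli operators of circuit 1 as controlled one-qubit Pauli gates) turns each of the four circuits, as well as the history state subroutine itself, into an elementary circuit that implements exactly the same unitary and has depth at most $K\,n\log_2N$. In particular the diagonalized subroutine maps $|0\rangle^{\otimes m}|\psi_0\rangle$ to the history state $\frac1{\sqrt N}\sum_{t=0}^{N-1}|t\rangle\,U(\varepsilon t)|\psi_0\rangle$. -/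

import Mathlib

open scoped Matrix

namespace HistoryCircuits

/-! ### Qubit registers and operators on them -/

/-- Operators on a register of qubits labelled by `Q`, in the computational basis. -/
abbrev Op (Q : Type) : Type := Matrix (Q → Fin 2) (Q → Fin 2) ℂ

/-- The one-qubit operator `A` acting on the qubit `q`, tensored with the identity elsewhere. -/
def site {Q : Type} [Fintype Q] [DecidableEq Q] (q : Q) (A : Matrix (Fin 2) (Fin 2) ℂ) : Op Q :=
  Matrix.of fun x y => if ∀ r, r ≠ q → x r = y r then A (x q) (y q) else 0

/-- The `k`-qubit operator `A` acting on the qubits `w 0, …, w (k-1)` (for injective `w`),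
tensored with the identity elsewhere. -/
def onWires {Q : Type} [Fintype Q] [DecidableEq Q] {k : ℕ} (w : Fin k → Q) (A : Op (Fin k)) :
    Op Q :=
  Matrix.of fun x y =>
    if ∀ r, (∀ i, w i ≠ r) → x r = y r then A (fun i => x (w i)) (fun i => y (w i)) else 0

/-- The controlled operator `|0⟩⟨0| ⊗ 1 + |1⟩⟨1| ⊗ A`; the control is qubit `0`. -/
def ctrl {k : ℕ} (A : Op (Fin k)) : Op (Fin (k + 1)) :=
  Matrix.of fun x y =>
    if x 0 = y 0 then
      if x 0 = 1 then A (fun i => x i.succ) (fun i => y i.succ)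
      else (1 : Op (Fin k)) (fun i => x i.succ) (fun i => y i.succ)
    else 0

def sigmaX : Matrix (Fin 2) (Fin 2) ℂ := !![0, 1; 1, 0]

def sigmaY : Matrix (Fin 2) (Fin 2) ℂ := !![0, -Complex.I; Complex.I, 0]

def sigmaZ : Matrix (Fin 2) (Fin 2) ℂ := !![1, 0; 0, -1]

noncomputable def hadamard : Matrix (Fin 2) (Fin 2) ℂ :=
  ((1 / Real.sqrt 2 : ℝ) : ℂ) • !![1, 1; 1, -1]

/-- The gate `S†`. -/
def sDagger : Matrix (Fin 2) (Fin 2) ℂ := !![1, 0; 0, -Complex.I]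

/-- The phase gate `diag(1, e^{-iφ})`. -/
noncomputable def phaseGate (φ : ℝ) : Matrix (Fin 2) (Fin 2) ℂ :=
  !![1, 0; 0, Complex.exp (-Complex.I * φ)]

/-- Labels of the one-qubit Pauli operators. -/
inductive Pauli : Type
  | I
  | X
  | Y
  | Z

def Pauli.mat : Pauli → Matrix (Fin 2) (Fin 2) ℂ
  | .I => 1
  | .X => sigmaX
  | .Y => sigmaY
  | .Z => sigmaZ

/-- The `n`-qubit Pauli operator `P 0 ⊗ ⋯ ⊗ P (n-1)`. -/
def pauliString {n : ℕ} (P : Fin n → Pauli) : Op (Fin n) :=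
  Matrix.of fun x y => ∏ k, (P k).mat (x k) (y k)

/-! ### Circuits and their depth -/

/-- A gate: an operator on `arity` qubits, applied to the qubits `wires`. -/
structure Gate (Q : Type) where
  arity : ℕ
  wires : Fin arity → Q
  op : Op (Fin arity)

/-- A one-qubit gate. -/
def Gate.one {Q : Type} (q : Q) (A : Matrix (Fin 2) (Fin 2) ℂ) : Gate Q :=
  ⟨1, ![q], site 0 A⟩

/-- The gate `A` on the qubits `w`, controlled by the qubit `c`. -/
def Gate.controlled {Q : Type} {k : ℕ} (c : Q) (w : Fin k → Q) (A : Op (Fin k)) : Gate Q :=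
  ⟨k + 1, Fin.cons c w, ctrl A⟩

def Gate.cnot {Q : Type} (c t : Q) : Gate Q :=
  Gate.controlled c ![t] (site 0 sigmaX)

/-- A circuit: its gates in the order in which they are applied (first gate first). -/
abbrev Circuit (Q : Type) : Type := List (Gate Q)

/-- The operator that a circuit implements. -/
def Circuit.eval {Q : Type} [Fintype Q] [DecidableEq Q] (C : Circuit Q) : Op Q :=
  C.foldl (fun M g => onWires g.wires g.op * M) 1

/-- Earliest-time scheduling: if the qubits are busy up to the times `f`, a further gate occupies
the first time step that is later than those of all its qubits. -/
def schedule {Q : Type} [DecidableEq Q] (f : Q → ℕ) (g : Gate Q) : Q → ℕ := fun q =>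
  if ∃ i, g.wires i = q then Finset.univ.sup (fun i => f (g.wires i)) + 1 else f q

/-- The depth of a circuit: its number of time steps when gates on disjoint sets of qubits may run
in parallel, that is, the length of a longest chain of gates that have to wait for one another. -/
def Circuit.depth {Q : Type} [Fintype Q] [DecidableEq Q] (C : Circuit Q) : ℕ :=
  Finset.univ.sup (C.foldl schedule fun _ => 0)

/-- Every gate is a unitary acting on one or two distinct qubits. -/
def Circuit.IsElementary {Q : Type} (C : Circuit Q) : Prop :=
  ∀ g ∈ C, (g.arity = 1 ∨ g.arity = 2) ∧ Function.Injective g.wires ∧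
    g.op ∈ Matrix.unitaryGroup (Fin g.arity → Fin 2) ℂ

/-- `C` implements the circuit `C'` (which may contain many-qubit gates) exactly, with one- and
two-qubit gates and in depth at most `d`. -/
def Circuit.Implements {Q : Type} [Fintype Q] [DecidableEq Q] (C C' : Circuit Q) (d : ℕ) : Prop :=
  C.IsElementary ∧ C.eval = C'.eval ∧ C.depth ≤ d

/-! ### The XY Hamiltonian and the variational ansatz (sites are numbered from `0`) -/

/-- The left site of the neighbouring pair number `j`. -/
def left {n : ℕ} (j : Fin (n - 1)) : Fin n := ⟨j, by omega⟩

/-- The right site of the neighbouring pair number `j`. -/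
def right {n : ℕ} (j : Fin (n - 1)) : Fin n := ⟨j + 1, by omega⟩

/-- `H = ∑ⱼ (axⱼ Xⱼ Xⱼ₊₁ + ayⱼ Yⱼ Yⱼ₊₁) + ∑ⱼ azⱼ Zⱼ`. -/
noncomputable def xyHamiltonian {n : ℕ} (ax ay : Fin (n - 1) → ℝ) (az : Fin n → ℝ) : Op (Fin n) :=
  (∑ j, ((ax j : ℂ) • (site (left j) sigmaX * site (right j) sigmaX) +
      (ay j : ℂ) • (site (left j) sigmaY * site (right j) sigmaY))) +
    ∑ j, (az j : ℂ) • site j sigmaZ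

/-- `U(t) = e^{-iHt}`. -/
noncomputable def evolution {n : ℕ} (H : Op (Fin n)) (t : ℝ) : Op (Fin n) :=
  NormedSpace.exp ((-Complex.I * t) • H)

/-- The diagonal ansatz `D(β) = ∑ⱼ βⱼ Zⱼ`. -/
noncomputable def diagAnsatz {n : ℕ} (β : Fin n → ℝ) : Op (Fin n) :=
  ∑ j, (β j : ℂ) • site j sigmaZ

/-- The local ansatz
`W(α) = ∏ₗ (∏ⱼ exp(i αxy l j Xⱼ Yⱼ₊₁) ∏ⱼ exp(i αyx l j Yⱼ Xⱼ₊₁))` with `L` layers, where the products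
over the neighbouring pairs are taken in the order `σ 0, σ 1, …` (`σ = 1` is the order
`j = 0, 1, …`; listing every other pair first is the brick-wall order). -/
noncomputable def ansatz {n L : ℕ} (σ : Equiv.Perm (Fin (n - 1)))
    (αxy αyx : Fin L → Fin (n - 1) → ℝ) : Op (Fin n) :=
  (List.ofFn fun l =>
    (List.ofFn fun i => NormedSpace.exp ((Complex.I * αxy l (σ i)) •
      (site (left (σ i)) sigmaX * site (right (σ i)) sigmaY : Op (Fin n)))).prod *
    (List.ofFn fun i => NormedSpace.exp ((Complex.I * αyx l (σ i)) •
      (site (left (σ i)) sigmaY * site (right (σ i)) sigmaX : Op (Fin n)))).prod).prod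

/-- The cost `‖H - W D W†‖² / 2ⁿ` in the Hilbert–Schmidt norm. -/
noncomputable def cost {n : ℕ} (H W D : Op (Fin n)) : ℝ :=
  ((H - W * D * Wᴴ)ᴴ * (H - W * D * Wᴴ)).trace.re / 2 ^ n

/-- The parameters are trained: the cost, which is nonnegative, is at its optimal value `0`. -/
def Trained {n L : ℕ} (H : Op (Fin n)) (σ : Equiv.Perm (Fin (n - 1)))
    (αxy αyx : Fin L → Fin (n - 1) → ℝ) (β : Fin n → ℝ) : Prop :=
  cost H (ansatz σ αxy αyx) (diagAnsatz β) = 0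

/-! ### The history state subroutine, on clock qubits `c` and system qubits `s` -/

section Blocks

variable {Q : Type} {m n L : ℕ}

/-- Hadamard gates on the qubits `c`. -/
noncomputable def hadamards (c : Fin m → Q) : Circuit Q :=
  List.ofFn fun j => Gate.one (c j) hadamard

/-- The evolution block in its original form: `U(2ʲ ε)` on the system controlled by clock qubit `j`,
for `j = 0, …, m-1`. -/
noncomputable def evolutionBlock (c : Fin m → Q) (s : Fin n → Q) (H : Op (Fin n)) (ε : ℝ) :
    Circuit Q :=
  List.ofFn fun j => Gate.controlled (c j) s (evolution H (2 ^ (j : ℕ) * ε))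

/-- The two-qubit gates of `W(α)`, in the order of the factors of the operator product. -/
noncomputable def ansatzGates (s : Fin n → Q) (σ : Equiv.Perm (Fin (n - 1)))
    (αxy αyx : Fin L → Fin (n - 1) → ℝ) : Circuit Q :=
  (List.ofFn fun l =>
    (List.ofFn fun i => (⟨2, ![s (left (σ i)), s (right (σ i))], NormedSpace.exp
      ((Complex.I * αxy l (σ i)) • (site 0 sigmaX * site 1 sigmaY : Op (Fin 2)))⟩ : Gate Q)) ++
    (List.ofFn fun i => (⟨2, ![s (left (σ i)), s (right (σ i))], NormedSpace.exp
      ((Complex.I * αyx l (σ i)) • (site 0 sigmaY * site 1 sigmaX : Op (Fin 2)))⟩ :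
        Gate Q))).flatten

/-- The circuit for `W(α)`; the rightmost factor of the product is applied first. -/
noncomputable def ansatzCircuit (s : Fin n → Q) (σ : Equiv.Perm (Fin (n - 1)))
    (αxy αyx : Fin L → Fin (n - 1) → ℝ) : Circuit Q :=
  (ansatzGates s σ αxy αyx).reverse

/-- The circuit for `W(α)†`: the inverse gates in the opposite order. -/
noncomputable def ansatzDaggerCircuit (s : Fin n → Q) (σ : Equiv.Perm (Fin (n - 1)))
    (αxy αyx : Fin L → Fin (n - 1) → ℝ) : Circuit Q :=
  ansatzGates s σ (-αxy) (-αyx)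

/-- The evolution block after diagonalization: `W†` on the system, then for every clock qubit `j`
the controlled `e^{-i D(β) 2ʲ ε}`, as the controlled one-qubit rotations `e^{-i βₖ 2ʲ ε Zₖ}`, and
finally `W` on the system. -/
noncomputable def diagonalBlock (c : Fin m → Q) (s : Fin n → Q) (σ : Equiv.Perm (Fin (n - 1)))
    (αxy αyx : Fin L → Fin (n - 1) → ℝ) (β : Fin n → ℝ) (ε : ℝ) : Circuit Q :=
  ansatzDaggerCircuit s σ αxy αyx ++
    (List.ofFn fun j : Fin m => List.ofFn fun k : Fin n =>
      Gate.controlled (c j) ![s k]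
        (NormedSpace.exp ((-Complex.I * (β k * (2 ^ (j : ℕ) * ε))) •
          (site 0 sigmaZ : Op (Fin 1))))).flatten ++
    ansatzCircuit s σ αxy αyx

/-- A Pauli operator on the system controlled by `a`, as a single many-qubit gate. -/
def controlledPauli (a : Q) (s : Fin n → Q) (P : Fin n → Pauli) : Circuit Q :=
  [Gate.controlled a s (pauliString P)]

/-- The same, as one controlled one-qubit Pauli gate per system qubit. -/
def controlledPauliSplit (a : Q) (s : Fin n → Q) (P : Fin n → Pauli) : Circuit Q :=
  List.ofFn fun k => Gate.controlled a ![s k] (site 0 (P k).mat)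

/-- The state overlap circuit: for every `j`, the change to the Bell basis of the pair
`(a j, b j)`, which is a CNOT followed by a Hadamard gate on `a j`. -/
noncomputable def overlapBlock {k : ℕ} (a b : Fin k → Q) : Circuit Q :=
  (List.ofFn fun j => [Gate.cnot (a j) (b j), Gate.one (a j) hadamard]).flatten

end Blocks

/-! ### The protocols

Each protocol is written for an arbitrary evolution block, so that the history state subroutine
(Hadamard gates on the clock, then the evolution block) can be exchanged. -/

/-- Clock and system. -/
abbrev RegH (m n : ℕ) : Type := Fin m ⊕ Fin n

/-- Clock, system, and one ancilla. -/
abbrev RegF (m n : ℕ) : Type := Fin m ⊕ (Fin n ⊕ Unit)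

/-- Clock, system, and a second system register for a copy of the initial state. -/
abbrev RegL (m n : ℕ) : Type := Fin m ⊕ (Fin n ⊕ Fin n)

/-- Two copies of clock and system. -/
abbrev RegE (m n : ℕ) : Type := RegH m n ⊕ RegH m n

section Protocols

variable {m n : ℕ}

/-- Preparation of the history state from `|0…0⟩ ⊗ |ψ₀⟩`. -/
noncomputable def historyCircuit (evol : Circuit (RegH m n)) : Circuit (RegH m n) :=
  hadamards Sum.inl ++ evol

/-- The circuit for the discrete-time average
`N⁻¹ ∑ₜ e^{-iωεt} ⟨O₁(εt) O₂⟩`, read off from `⟨Z⟩` on the ancilla (real part, or, with the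
additional gate `S†`, imaginary part). The blocks `cO₂`, `cO₁` are the controlled operators. -/
noncomputable def correlationCircuit (evol cO₂ cO₁ : Circuit (RegF m n)) (imag : Bool)
    (ω ε : ℝ) : Circuit (RegF m n) :=
  hadamards Sum.inl ++ [Gate.one (Sum.inr (Sum.inr ())) hadamard] ++
    (if imag then [Gate.one (Sum.inr (Sum.inr ())) sDagger] else []) ++
    cO₂ ++ evol ++ cO₁ ++
    (List.ofFn fun j : Fin m => Gate.controlled (Sum.inl j) ![Sum.inr (Sum.inr ())]
      (site 0 (phaseGate (2 ^ (j : ℕ) * (ω * ε))))) ++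
    [Gate.one (Sum.inr (Sum.inr ())) hadamard]

/-- The circuit for the discrete-time Loschmidt echo `N⁻¹ ∑ₜ |⟨ψ₀|U(εt)|ψ₀⟩|²`: history state,
then state overlap of its system qubits with the second copy of `|ψ₀⟩`. -/
noncomputable def loschmidtCircuit (evol : Circuit (RegL m n)) : Circuit (RegL m n) :=
  hadamards Sum.inl ++ evol ++
    overlapBlock (fun k => Sum.inr (Sum.inl k)) (fun k => Sum.inr (Sum.inr k))

/-- The circuit for the linear entropy `E₂ = 1 - Tr ρ_T²` through the state overlap of the clocks of
two history states. -/
noncomputable def entropyOverlapCircuit (evol₁ evol₂ : Circuit (RegE m n)) :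
    Circuit (RegE m n) :=
  (hadamards (fun j => Sum.inl (Sum.inl j)) ++ evol₁) ++
    (hadamards (fun j => Sum.inr (Sum.inl j)) ++ evol₂) ++
    overlapBlock (fun j => Sum.inl (Sum.inl j)) (fun j => Sum.inr (Sum.inl j))

/-- The circuit for `E₂` through randomized measurements: history state, then the drawn one-qubit
unitary `u j` on clock qubit `j`. -/
noncomputable def entropyRandomCircuit (evol : Circuit (RegH m n))
    (u : Fin m → Matrix.unitaryGroup (Fin 2) ℂ) : Circuit (RegH m n) :=
  hadamards Sum.inl ++ evol ++ List.ofFn fun j => Gate.one (Sum.inl j) (u j).1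

/-- `|0…0⟩ ⊗ |ψ₀⟩`. -/
def initialState (ψ₀ : (Fin n → Fin 2) → ℂ) : (RegH m n → Fin 2) → ℂ := fun x =>
  if ∀ j : Fin m, x (Sum.inl j) = 0 then ψ₀ fun k => x (Sum.inr k) else 0

/-- The time `t = ∑ⱼ tⱼ 2ʲ` that the clock qubits show. -/
def clockTime (x : RegH m n → Fin 2) : ℕ := ∑ j : Fin m, (x (Sum.inl j) : ℕ) * 2 ^ (j : ℕ)

/-- The history state `N^{-1/2} ∑ₜ |t⟩ ⊗ U(εt)|ψ₀⟩` with `N = 2^m`. -/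
noncomputable def historyState (H : Op (Fin n)) (ε : ℝ) (ψ₀ : (Fin n → Fin 2) → ℂ) :
    (RegH m n → Fin 2) → ℂ := fun x =>
  ((1 / Real.sqrt (2 ^ m) : ℝ) : ℂ) *
    (evolution H (ε * clockTime x) *ᵥ ψ₀) fun k => x (Sum.inr k)

end Protocols

end HistoryCircuits

open HistoryCircuits

open scoped Matrix Kronecker

set_option linter.unusedSectionVars false

namespace HistoryCircuits

/-! ### Operators on some of the wires of a register -/

section Wires

variable {Q : Type} {k : ℕ}

/-! Existence of trained parameters is a statement about free fermions. With the Majorana operators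
`a_j = Z⋯ZX` and `b_j = Z⋯ZY`, every term of the `XY` Hamiltonian pairs one `a` with one `b`, so `H
= -i ∑ M l p a_l b_p` for a real matrix `M`, and `D(β)` is the case `M = diag β`. The generators of
the ansatz are bilinears of one kind only: `X_j Y_{j+1}` in the `b`, `Y_j X_{j+1}` in the `a`.
Conjugation by `W` therefore rotates the `a` by a matrix `R` and the `b` by a matrix `S`, with
independent angles, and turns `M` into `R M Sᵀ` (`rotates_ansatz`, `quadratic_rotate`).
Diagonalizing `H` becomes the singular value decomposition of `M`. It remains to realize the two
orthogonal factors: up to column signs, which `β` absorbs, an orthogonal `n × n` matrix is a product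
of `n` ladders of rotations of neighbouring coordinates (`exists_ladders`), one ladder per layer.

For the circuits, zero cost means `H = W D W†`, hence `U(t) = W e^{-iDt} W†`. As `W` does not act on
the clock, a control on this product is needed only on `e^{-iDt}` (`controlBy_conj`), and the inner
`W† W` between successive clock qubits cancel. A single `W†` and a single `W` are left, around `m n`
controlled rotations (`eval_diagonalBlock`).

The depth count is trivial except for the ansatz, where gates are ordered arbitrarily within a layer
and layers must overlap in time to give `O(L + n)` steps rather than `O(L n)`. Labels that increase
along chains of gates sharing a qubit bound the depth (`delayLE_of_labels`). They are built from a
height of the neighbouring pairs that follows the order and changes by one from pair to pair,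
shifted by two for each half layer (`pairwise_ansatzLabel`). -/

theorem injective_vec_one (q : Q) : Function.Injective ![q] := fun _ _ _ => Subsingleton.elim _ _

theorem injective_vec_two {q r : Q} (h : q ≠ r) : Function.Injective ![q, r] := by
  intro i j
  fin_cases i <;> fin_cases j <;> simp [h, h.symm]

theorem injective_cons {c : Q} {w : Fin k → Q} (hw : Function.Injective w) (hc : ∀ i, w i ≠ c) :
    Function.Injective (Fin.cons c w : Fin (k + 1) → Q) :=
  Fin.cons_injective_iff.2 ⟨fun ⟨i, hi⟩ => hc i hi, hw⟩

variable [Fintype Q] [DecidableEq Q]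

/-- Basis states of a register as pairs of the values on the wires `w` and elsewhere. -/
noncomputable def splitWires (w : Fin k → Q) (hw : Function.Injective w) :
    (Q → Fin 2) ≃ (Fin k → Fin 2) × ({r // ∀ i, w i ≠ r} → Fin 2) :=
  Equiv.ofBijective (fun x => (fun i => x (w i), fun r => x r)) <| by
    constructor
    · intro x y h
      simp only [Prod.mk.injEq] at h
      funext r
      by_cases hr : ∀ i, w i ≠ r
      · exact congrFun h.2 ⟨r, hr⟩
      · push Not at hr
        obtain ⟨i, rfl⟩ := hr
        exact congrFun h.1 i
    · classical
      rintro ⟨u, v⟩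
      refine ⟨fun r => if h : ∃ i, w i = r then u h.choose else
        v ⟨r, fun i hi => h ⟨i, hi⟩⟩, ?_⟩
      ext1
      · funext i
        have h : ∃ i', w i' = w i := ⟨i, rfl⟩
        simp only [h, dif_pos]
        exact congrArg u (hw h.choose_spec)
      · funext r
        have h : ¬ ∃ i', w i' = r.1 := fun ⟨i, hi⟩ => r.2 i hi
        simp only [h, dif_neg, not_false_eq_true]

/-- Reduces the multiplicative properties of embedded operators to those of Kronecker products. -/
theorem onWires_eq_kronecker (w : Fin k → Q) (hw : Function.Injective w) (A : Op (Fin k)) :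
    onWires w A = (A ⊗ₖ (1 : Matrix ({r // ∀ i, w i ≠ r} → Fin 2) _ ℂ)).submatrix
      (splitWires w hw) (splitWires w hw) := by
  ext x y
  have h : (splitWires w hw x).2 = (splitWires w hw y).2 ↔ ∀ r, (∀ i, w i ≠ r) → x r = y r :=
    funext_iff.trans Subtype.forall
  rw [Matrix.submatrix_apply, Matrix.kroneckerMap_apply, Matrix.one_apply, mul_ite, mul_one,
    mul_zero]
  simp only [h]
  rfl

theorem onWires_one (w : Fin k → Q) (hw : Function.Injective w) : onWires w 1 = 1 := by
  rw [onWires_eq_kronecker w hw, Matrix.one_kronecker_one, Matrix.submatrix_one_equiv]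

theorem onWires_mul (w : Fin k → Q) (hw : Function.Injective w) (A B : Op (Fin k)) :
    onWires w (A * B) = onWires w A * onWires w B := by
  simp only [onWires_eq_kronecker w hw]
  rw [Matrix.submatrix_mul_equiv, ← Matrix.mul_kronecker_mul, one_mul]

theorem onWires_add (w : Fin k → Q) (A B : Op (Fin k)) :
    onWires w (A + B) = onWires w A + onWires w B := by
  ext x y
  simp only [onWires, Matrix.of_apply, Matrix.add_apply]
  split_ifs <;> simp

theorem onWires_smul (w : Fin k → Q) (a : ℂ) (A : Op (Fin k)) :
    onWires w (a • A) = a • onWires w A := by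
  ext x y
  simp only [onWires, Matrix.of_apply, Matrix.smul_apply]
  split_ifs <;> simp

theorem onWires_conjTranspose (w : Fin k → Q) (A : Op (Fin k)) :
    onWires w Aᴴ = (onWires w A)ᴴ := by
  ext x y
  simp only [onWires, Matrix.of_apply, Matrix.conjTranspose_apply, eq_comm (a := y _)]
  split_ifs <;> simp

theorem onWires_list_prod (w : Fin k → Q) (hw : Function.Injective w) (l : List (Op (Fin k))) :
    onWires w l.prod = (l.map (onWires w)).prod := by
  induction l with
  | nil => simpa using onWires_one w hw
  | cons A l ih => simp [onWires_mul w hw, ih]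

theorem onWires_onWires {k' : ℕ} (w : Fin k → Q) (hw : Function.Injective w) (v : Fin k' → Fin k)
    (A : Op (Fin k')) : onWires w (onWires v A) = onWires (fun i => w (v i)) A := by
  ext x y
  simp only [onWires, Matrix.of_apply, ← ite_and]
  congr 1
  refine propext ⟨fun ⟨h₁, h₂⟩ r hr => ?_, fun h => ⟨fun r hr => h r fun i => hr _,
    fun r hr => h _ fun i hi => hr i (hw hi)⟩⟩
  by_cases h : ∀ i, w i ≠ r
  · exact h₁ r h
  · push Not at h
    obtain ⟨i, rfl⟩ := h
    exact h₂ i fun i' hi' => hr i' (congrArg w hi')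

theorem site_eq_onWires (q : Q) (A : Matrix (Fin 2) (Fin 2) ℂ) :
    site q A = onWires ![q] (site 0 A) := by
  ext x y
  simp only [site, onWires, Matrix.of_apply, Fin.forall_fin_one, Matrix.cons_val_fin_one]
  simp [eq_comm]

theorem onWires_site (w : Fin k → Q) (hw : Function.Injective w) (i : Fin k)
    (A : Matrix (Fin 2) (Fin 2) ℂ) : onWires w (site i A) = site (w i) A := by
  rw [site_eq_onWires, onWires_onWires w hw, site_eq_onWires (w i)]
  congr 1
  funext j
  fin_cases j
  rfl

/-- The matrix `B` preserves the value of the qubit `c`. -/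
def Preserves (c : Q) (B : Op Q) : Prop := ∀ x y, x c ≠ y c → B x y = 0

/-- Applied below to the two projections from which `controlBy` is built. -/
theorem Preserves.commute {c : Q} {A : Op Q} (hA : Preserves c A) (f : Fin 2 → ℂ) :
    Commute (Matrix.diagonal fun x : Q → Fin 2 => f (x c)) A := by
  ext x y
  rw [Matrix.diagonal_mul, Matrix.mul_diagonal]
  by_cases h : x c = y c
  · rw [h, mul_comm]
  · rw [hA x y h, zero_mul, mul_zero]

/-- The operator `B` controlled by the qubit `c`, for a `B` which does not act on `c`. -/
def controlBy (c : Q) (B : Op Q) : Op Q :=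
  Matrix.diagonal (fun x => if x c = 1 then 0 else 1) +
    Matrix.diagonal (fun x => if x c = 1 then 1 else 0) * B

theorem controlBy_apply (c : Q) (B : Op Q) (x y : Q → Fin 2) :
    controlBy c B x y = if x c = 1 then B x y else (1 : Op Q) x y := by
  simp only [controlBy, Matrix.add_apply, Matrix.diagonal_mul, Matrix.diagonal_apply,
    Matrix.one_apply]
  split_ifs <;> simp

theorem controlBy_one (c : Q) : controlBy c (1 : Op Q) = 1 := by
  ext x y
  simp [controlBy_apply]

/-- Where the control is `1`, the left factor must keep it at `1` for the control of the right
factor to fire too. -/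
theorem controlBy_mul {c : Q} {A : Op Q} (hA : Preserves c A) (B : Op Q) :
    controlBy c (A * B) = controlBy c A * controlBy c B := by
  ext x y
  rw [controlBy_apply, Matrix.mul_apply, Matrix.mul_apply]
  simp only [controlBy_apply]
  split_ifs with h
  · refine Finset.sum_congr rfl fun z _ => ?_
    by_cases hz : z c = 1
    · rw [if_pos hz]
    · rw [hA x z (by rw [h]; exact fun h' => hz h'.symm), zero_mul, zero_mul]
  · rw [Finset.sum_eq_single x]
    · simp [h]
    · intro z _ hz
      rw [Matrix.one_apply_ne hz.symm, zero_mul]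
    · simp

/-- The projections commute with `A`; in the idle branch what remains is `A * A' = 1`. This is why
`W` and `W†` need no control. -/
theorem controlBy_conj {c : Q} {A : Op Q} (hA : Preserves c A) (A' B : Op Q) (h : A * A' = 1) :
    controlBy c (A * B * A') = A * controlBy c B * A' := by
  have h₀ := (hA.commute fun b => if b = 1 then 0 else 1).eq
  have h₁ := (hA.commute fun b => if b = 1 then 1 else 0).eq
  simp only [controlBy, mul_add, add_mul, ← mul_assoc]
  rw [← h₀, ← h₁, mul_assoc _ A A', h, mul_one]

theorem controlBy_conjTranspose {c : Q} {B : Op Q} (hB : Preserves c B) :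
    (controlBy c B)ᴴ = controlBy c Bᴴ := by
  ext x y
  rw [Matrix.conjTranspose_apply, controlBy_apply, controlBy_apply, Matrix.conjTranspose_apply]
  by_cases h : x c = y c
  · rw [h, Matrix.one_apply, Matrix.one_apply]
    simp only [eq_comm (a := y)]
    split_ifs <;> simp
  · rw [hB y x (Ne.symm h), Matrix.one_apply_ne (fun h' => h (congrFun h' c)),
      Matrix.one_apply_ne (fun h' => h (congrFun h' c).symm)]
    simp

theorem preserves_onWires {c : Q} {w : Fin k → Q} (hc : ∀ i, w i ≠ c) (A : Op (Fin k)) :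
    Preserves c (onWires w A) := by
  intro x y h
  simp only [onWires, Matrix.of_apply]
  rw [if_neg fun h' => h (h' c hc)]

/-- Passes from gates with a control wire to `controlBy` on the whole register, where the algebra of
controls takes place. -/
theorem onWires_ctrl {c : Q} {w : Fin k → Q} (hw : Function.Injective w) (hc : ∀ i, w i ≠ c)
    (A : Op (Fin k)) :
    onWires (Fin.cons c w : Fin (k + 1) → Q) (ctrl A) = controlBy c (onWires w A) := by
  ext x y
  have key : (∀ r, (∀ i, (Fin.cons c w : Fin (k + 1) → Q) i ≠ r) → x r = y r) ∧ x c = y c ↔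
      ∀ r, (∀ i, w i ≠ r) → x r = y r := by
    simp only [Fin.forall_fin_succ, Fin.cons_zero, Fin.cons_succ]
    constructor
    · rintro ⟨h₁, h₂⟩ r hr
      by_cases hcr : c = r
      · rw [← hcr, h₂]
      · exact h₁ r ⟨hcr, hr⟩
    · exact fun h => ⟨fun r hr => h r hr.2, h c hc⟩
  rw [controlBy_apply, ← onWires_one w hw]
  simp only [onWires, ctrl, Matrix.of_apply, Fin.cons_zero, Fin.cons_succ]
  by_cases h₁ : ∀ r, (∀ i, w i ≠ r) → x r = y r
  · rw [if_pos (key.2 h₁).1, if_pos (key.2 h₁).2]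
    simp only [if_pos h₁]
    rfl
  · simp only [if_neg h₁, ite_self]
    by_cases h₂ : x c = y c
    · rw [if_neg fun h => h₁ (key.1 ⟨h, h₂⟩)]
    · simp [h₂]

theorem onWires_mem_unitaryGroup {w : Fin k → Q} (hw : Function.Injective w) {A : Op (Fin k)}
    (hA : A ∈ Matrix.unitaryGroup _ ℂ) : onWires w A ∈ Matrix.unitaryGroup _ ℂ := by
  rw [Matrix.mem_unitaryGroup_iff, Matrix.star_eq_conjTranspose] at hA ⊢
  rw [← onWires_conjTranspose, ← onWires_mul w hw, hA, onWires_one w hw]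

theorem onWires_id (A : Op (Fin k)) : onWires (fun i => i) A = A := by
  ext x y
  simp only [onWires, Matrix.of_apply]
  rw [if_pos fun r hr => absurd rfl (hr r)]

theorem ctrl_mem_unitaryGroup {A : Op (Fin k)} (hA : A ∈ Matrix.unitaryGroup _ ℂ) :
    ctrl A ∈ Matrix.unitaryGroup _ ℂ := by
  have hc : ∀ i : Fin k, i.succ ≠ 0 := Fin.succ_ne_zero
  -- The wires of the gate themselves form a register, so unitarity follows from the
  -- multiplicativity of `controlBy`.
  have h : ctrl A = controlBy 0 (onWires Fin.succ A) := by
    rw [← onWires_ctrl (Fin.succ_injective k) hc]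
    convert (onWires_id (ctrl A)).symm using 2
    exact Fin.cons_self_tail (fun i : Fin (k + 1) => i)
  have hu := onWires_mem_unitaryGroup (Fin.succ_injective k) hA
  rw [Matrix.mem_unitaryGroup_iff, Matrix.star_eq_conjTranspose] at hu ⊢
  rw [h, controlBy_conjTranspose (preserves_onWires hc A),
    ← controlBy_mul (preserves_onWires hc A), hu, controlBy_one]

end Wires

/-! ### Tensor products of one-qubit operators -/

section Tensor

variable {Q : Type} [Fintype Q] [DecidableEq Q]

/-- The tensor product of the one-qubit operators `A q`. -/
def tensor (A : Q → Matrix (Fin 2) (Fin 2) ℂ) : Op Q :=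
  Matrix.of fun x y => ∏ q, A q (x q) (y q)

theorem tensor_mul (A B : Q → Matrix (Fin 2) (Fin 2) ℂ) :
    tensor (A * B) = tensor A * tensor B := by
  ext x y
  simp only [tensor, Matrix.mul_apply, Matrix.of_apply, Pi.mul_apply, Fintype.prod_sum,
    Finset.prod_mul_distrib]

theorem tensor_diagonal (d : Q → Fin 2 → ℂ) :
    tensor (fun q => Matrix.diagonal (d q)) =
      Matrix.diagonal fun x : Q → Fin 2 => ∏ q, d q (x q) := by
  ext x y
  simp only [tensor, Matrix.of_apply, Matrix.diagonal_apply]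
  split_ifs with h
  · simp [h]
  · obtain ⟨q, hq⟩ := Function.ne_iff.1 h
    exact Finset.prod_eq_zero (Finset.mem_univ q) (if_neg hq)

theorem tensor_one : tensor (1 : Q → Matrix (Fin 2) (Fin 2) ℂ) = 1 := by
  have := tensor_diagonal (Q := Q) fun _ _ => 1
  simp only [Finset.prod_const_one] at this
  rw [Matrix.diagonal_one] at this
  rw [← Matrix.diagonal_one, ← this]
  congr 1

theorem tensor_conjTranspose (A : Q → Matrix (Fin 2) (Fin 2) ℂ) :
    (tensor A)ᴴ = tensor fun q => (A q)ᴴ := by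
  ext x y
  simp [tensor, Matrix.conjTranspose_apply]

/-- Supplies the sign in the Jordan–Wigner anticommutation relations, which arises at a single site.
-/
theorem tensor_eq_smul {A B : Q → Matrix (Fin 2) (Fin 2) ℂ} (q : Q) (c : ℂ) (hq : A q = c • B q)
    (h : ∀ r, r ≠ q → A r = B r) : tensor A = c • tensor B := by
  ext x y
  simp only [tensor, Matrix.of_apply, Matrix.smul_apply, smul_eq_mul]
  rw [← Finset.mul_prod_erase _ _ (Finset.mem_univ q),
    ← Finset.mul_prod_erase Finset.univ (fun q => B q (x q) (y q)) (Finset.mem_univ q), hq,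
    Finset.prod_congr rfl fun r hr => by rw [h r (Finset.ne_of_mem_erase hr)], Matrix.smul_apply,
    smul_eq_mul, mul_assoc]

theorem site_eq_tensor (q : Q) (A : Matrix (Fin 2) (Fin 2) ℂ) :
    site q A = tensor (Pi.mulSingle q A) := by
  ext x y
  simp only [site, tensor, Matrix.of_apply]
  rw [← Finset.mul_prod_erase _ _ (Finset.mem_univ q), Pi.mulSingle_eq_same]
  split_ifs with h
  · rw [Finset.prod_eq_one, mul_one]
    intro r hr
    have hr := Finset.ne_of_mem_erase hr
    rw [Pi.mulSingle_eq_of_ne hr, h r hr, Matrix.one_apply_eq]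
  · push Not at h
    obtain ⟨r, hr, hxy⟩ := h
    rw [Finset.prod_eq_zero (Finset.mem_erase.2 ⟨hr, Finset.mem_univ r⟩), mul_zero]
    rw [Pi.mulSingle_eq_of_ne hr, Matrix.one_apply_ne hxy]

theorem site_mul (q : Q) (A B : Matrix (Fin 2) (Fin 2) ℂ) :
    site q (A * B) = site q A * site q B := by
  rw [site_eq_tensor, site_eq_tensor, site_eq_tensor, ← tensor_mul, Pi.mulSingle_mul]

theorem site_one (q : Q) : site q 1 = 1 := by
  rw [site_eq_tensor, Pi.mulSingle_one, tensor_one]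

theorem site_conjTranspose (q : Q) (A : Matrix (Fin 2) (Fin 2) ℂ) :
    (site q A)ᴴ = site q Aᴴ := by
  rw [site_eq_tensor, site_eq_tensor, tensor_conjTranspose]
  congr 1
  funext r
  by_cases h : r = q
  · subst h; simp
  · simp [Pi.mulSingle_eq_of_ne h]

theorem site_mem_unitaryGroup (q : Q) {A : Matrix (Fin 2) (Fin 2) ℂ}
    (hA : A ∈ Matrix.unitaryGroup _ ℂ) : site q A ∈ Matrix.unitaryGroup _ ℂ := by
  rw [Matrix.mem_unitaryGroup_iff, Matrix.star_eq_conjTranspose] at hA ⊢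
  rw [site_conjTranspose, ← site_mul, hA, site_one]

theorem site_diagonal (q : Q) (d : Fin 2 → ℂ) :
    site q (Matrix.diagonal d) = Matrix.diagonal fun x => d (x q) := by
  ext x y
  simp only [site, Matrix.of_apply, Matrix.diagonal_apply]
  by_cases h : x = y
  · simp [h]
  · rw [if_neg h]
    obtain ⟨q', hq'⟩ := Function.ne_iff.1 h
    split_ifs with h₁ h₂
    · by_cases hqq : q' = q
      · exact absurd h₂ (hqq ▸ hq')
      · exact absurd (h₁ _ hqq) hq'
    · rfl
    · rfl

theorem list_prod_site (A : Q → Matrix (Fin 2) (Fin 2) ℂ) (l : List Q) (hl : l.Nodup) :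
    (l.map fun q => site q (A q)).prod = tensor fun q => if q ∈ l then A q else 1 := by
  induction l with
  | nil =>
    rw [List.map_nil, List.prod_nil, ← tensor_one]
    rfl
  | cons q l ih =>
    rw [List.nodup_cons] at hl
    rw [List.map_cons, List.prod_cons, ih hl.2, site_eq_tensor, ← tensor_mul]
    congr 1
    funext r
    rw [Pi.mul_apply]
    by_cases hr : r = q
    · subst hr
      simp [hl.1]
    · simp [hr]

/-- A tensor product is the product of its factors in any order. -/
theorem tensor_eq_list_prod (A : Q → Matrix (Fin 2) (Fin 2) ℂ) (l : List Q) (hl : l.Nodup)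
    (h : ∀ q, q ∈ l) : tensor A = (l.map fun q => site q (A q)).prod := by
  rw [list_prod_site A l hl]
  simp [h]

theorem sigmaX_mul_self : sigmaX * sigmaX = 1 := by
  ext i j; fin_cases i <;> fin_cases j <;> simp [sigmaX]

theorem sigmaY_mul_self : sigmaY * sigmaY = 1 := by
  ext i j; fin_cases i <;> fin_cases j <;> simp [sigmaY]

theorem sigmaZ_mul_self : sigmaZ * sigmaZ = 1 := by
  ext i j; fin_cases i <;> fin_cases j <;> simp [sigmaZ]

theorem sigmaX_conjTranspose : sigmaXᴴ = sigmaX := by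
  ext i j; fin_cases i <;> fin_cases j <;> simp [sigmaX]

theorem sigmaY_conjTranspose : sigmaYᴴ = sigmaY := by
  ext i j; fin_cases i <;> fin_cases j <;> simp [sigmaY]

theorem sigmaZ_conjTranspose : sigmaZᴴ = sigmaZ := by
  ext i j; fin_cases i <;> fin_cases j <;> simp [sigmaZ]

theorem mem_unitaryGroup_of_mul_self {d : Type} [Fintype d] [DecidableEq d] {A : Matrix d d ℂ}
    (h : A * A = 1) (h' : Aᴴ = A) : A ∈ Matrix.unitaryGroup d ℂ := by
  rw [Matrix.mem_unitaryGroup_iff, Matrix.star_eq_conjTranspose, h', h]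

theorem Pauli.mat_mem_unitaryGroup (P : Pauli) : P.mat ∈ Matrix.unitaryGroup _ ℂ := by
  cases P
  · exact one_mem _
  · exact mem_unitaryGroup_of_mul_self sigmaX_mul_self sigmaX_conjTranspose
  · exact mem_unitaryGroup_of_mul_self sigmaY_mul_self sigmaY_conjTranspose
  · exact mem_unitaryGroup_of_mul_self sigmaZ_mul_self sigmaZ_conjTranspose

theorem hadamard_mem_unitaryGroup : hadamard ∈ Matrix.unitaryGroup _ ℂ := by
  have h : ((1 / Real.sqrt 2 : ℝ) : ℂ) * ((1 / Real.sqrt 2 : ℝ) : ℂ) = 1 / 2 := by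
    rw [← Complex.ofReal_mul, div_mul_div_comm, Real.mul_self_sqrt (by norm_num)]
    norm_num
  apply mem_unitaryGroup_of_mul_self
  · rw [hadamard, smul_mul_smul_comm, h]
    ext i j; fin_cases i <;> fin_cases j <;> simp <;> norm_num
  · rw [hadamard, Matrix.conjTranspose_smul]
    congr 1
    · simp
    · ext i j; fin_cases i <;> fin_cases j <;> simp

theorem diagonal_exp_mem_unitaryGroup {d : Type} [Fintype d] [DecidableEq d] (f : d → ℝ) :
    Matrix.diagonal (fun x => Complex.exp (-Complex.I * f x)) ∈ Matrix.unitaryGroup d ℂ := by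
  rw [Matrix.mem_unitaryGroup_iff, Matrix.star_eq_conjTranspose, Matrix.diagonal_conjTranspose,
    Matrix.diagonal_mul_diagonal, ← Matrix.diagonal_one]
  congr 1
  funext x
  simp [← Complex.exp_conj, ← Complex.exp_add]

theorem phaseGate_mem_unitaryGroup (φ : ℝ) : phaseGate φ ∈ Matrix.unitaryGroup _ ℂ := by
  convert diagonal_exp_mem_unitaryGroup ![0, φ] using 1
  ext i j; fin_cases i <;> fin_cases j <;> simp [phaseGate]

theorem sDagger_mem_unitaryGroup : sDagger ∈ Matrix.unitaryGroup _ ℂ := by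
  rw [Matrix.mem_unitaryGroup_iff]
  ext i j; fin_cases i <;> fin_cases j <;> simp [sDagger, Matrix.mul_apply]

end Tensor

/-! ### Exponentials -/

section Exp

variable {d : Type} [Fintype d] [DecidableEq d]

/-- As `P² = 1`, mapping `(z₁, z₂)` to `z₁ (1 + P)/2 + z₂ (1 - P)/2` is a continuous ring
homomorphism from `ℂ × ℂ`. It commutes with the exponential, which is computed componentwise on the
left. -/
theorem exp_involution (P : Matrix d d ℂ) (hP : P * P = 1) (θ : ℂ) :
    NormedSpace.exp ((Complex.I * θ) • P) =
      Complex.cos θ • (1 : Matrix d d ℂ) + (Complex.I * Complex.sin θ) • P := by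
  let φ : ℂ × ℂ →+* Matrix d d ℂ :=
    { toFun := fun z => ((z.1 + z.2) / 2) • (1 : Matrix d d ℂ) + ((z.1 - z.2) / 2) • P
      map_one' := by simp
      map_zero' := by simp
      map_add' := fun y z => by simp only [Prod.fst_add, Prod.snd_add]; module
      map_mul' := fun y z => by
        simp only [Prod.fst_mul, Prod.snd_mul, mul_add, add_mul, smul_mul_smul_comm, hP, one_mul,
          mul_one]
        module }
  have hφ : Continuous φ := by
    change Continuous fun z : ℂ × ℂ =>
      ((z.1 + z.2) / 2) • (1 : Matrix d d ℂ) + ((z.1 - z.2) / 2) • P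
    fun_prop
  have h : φ (NormedSpace.exp (Complex.I * θ, -(Complex.I * θ))) =
      NormedSpace.exp (φ (Complex.I * θ, -(Complex.I * θ))) :=
    open scoped Matrix.Norms.Operator in NormedSpace.map_exp φ hφ _
  have h₁ : φ (Complex.I * θ, -(Complex.I * θ)) = (Complex.I * θ) • P := by
    change ((_ + _) / 2 : ℂ) • (1 : Matrix d d ℂ) + ((_ - _) / 2 : ℂ) • P = _
    simp
  rw [← h₁, ← h]
  change (((NormedSpace.exp _ : ℂ × ℂ).1 + (NormedSpace.exp _ : ℂ × ℂ).2) / 2 : ℂ) •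
    (1 : Matrix d d ℂ) + (((NormedSpace.exp _ : ℂ × ℂ).1 - (NormedSpace.exp _ : ℂ × ℂ).2) / 2 : ℂ) •
      P = _
  rw [Prod.fst_exp, Prod.snd_exp, ← Complex.exp_eq_exp_ℂ, mul_comm Complex.I θ, ← neg_mul,
    Complex.exp_mul_I, Complex.exp_mul_I, Complex.cos_neg, Complex.sin_neg]
  congr 2 <;> ring

theorem exp_smul_conjTranspose (P : Matrix d d ℂ) (hP' : Pᴴ = P) (θ : ℝ) :
    (NormedSpace.exp ((Complex.I * θ) • P))ᴴ = NormedSpace.exp ((Complex.I * (-θ : ℝ)) • P) := by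
  rw [← Matrix.exp_conjTranspose, Matrix.conjTranspose_smul, hP']
  simp

theorem exp_mem_unitaryGroup (P : Matrix d d ℂ) (hP' : Pᴴ = P) (θ : ℝ) :
    NormedSpace.exp ((Complex.I * θ) • P) ∈ Matrix.unitaryGroup d ℂ := by
  rw [Matrix.mem_unitaryGroup_iff, Matrix.star_eq_conjTranspose,
    exp_smul_conjTranspose P hP', ← Matrix.exp_add_of_commute]
  · simp
  · exact (Commute.refl P).smul_left _ |>.smul_right _

end Exp

/-! ### Circuits: operators, depth, elementary gates -/

section Circuits

variable {Q : Type} [Fintype Q] [DecidableEq Q]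

/-- The operator of a gate on the whole register. -/
def Gate.toOp (g : Gate Q) : Op Q := onWires g.wires g.op

theorem Circuit.eval_eq_prod (C : Circuit Q) : C.eval = (C.map Gate.toOp).reverse.prod := by
  have key : ∀ (C : Circuit Q) (M : Op Q),
      C.foldl (fun M g => onWires g.wires g.op * M) M = (C.map Gate.toOp).reverse.prod * M := by
    intro C
    induction C with
    | nil => simp
    | cons g C ih =>
      intro M
      rw [List.foldl_cons, ih, List.map_cons, List.reverse_cons, List.prod_append,
        List.prod_singleton, mul_assoc]
      rfl
  rw [Circuit.eval, key, mul_one]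

theorem Circuit.eval_append (C C' : Circuit Q) :
    Circuit.eval (C ++ C') = Circuit.eval C' * Circuit.eval C := by
  simp [Circuit.eval_eq_prod]

theorem Circuit.eval_flatten (l : List (Circuit Q)) :
    Circuit.eval l.flatten = (l.map Circuit.eval).reverse.prod := by
  induction l with
  | nil => simp [Circuit.eval]
  | cons C l ih => simp [Circuit.eval_append, ih]

/-- Scheduling the circuit delays every register that is busy up to some time by at most `T`. -/
def DelayLE (C : Circuit Q) (T : ℕ) : Prop :=
  ∀ (f : Q → ℕ) (A : ℕ), (∀ q, f q ≤ A) → ∀ q, C.foldl schedule f q ≤ A + T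

/-- Delays add because they are measured from an arbitrary busy register and not, like the depth,
from an idle one. -/
theorem DelayLE.append {C C' : Circuit Q} {T T' : ℕ} (h : DelayLE C T) (h' : DelayLE C' T') :
    DelayLE (C ++ C') (T + T') := by
  intro f A hf q
  rw [List.foldl_append, ← add_assoc]
  exact h' _ _ (h f A hf) q

theorem DelayLE.depth_le {C : Circuit Q} {T : ℕ} (h : DelayLE C T) : C.depth ≤ T :=
  Finset.sup_le fun q _ => by simpa using h (fun _ => 0) 0 (fun _ => le_rfl) q

theorem DelayLE.mono {C : Circuit Q} {T T' : ℕ} (h : DelayLE C T) (hT : T ≤ T') : DelayLE C T' :=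
  fun f A hf q => (h f A hf q).trans (by omega)

/-- If gates sharing a qubit carry labels which increase along the circuit, then the largest label
bounds the number of time steps. -/
theorem delayLE_of_labels {ι : Type} (g : ι → Gate Q) (τ : ι → ℕ) (T : ℕ) (l : List ι)
    (hτ : ∀ a ∈ l, 1 ≤ τ a ∧ τ a ≤ T)
    (hl : l.Pairwise fun a b => (∃ i j, (g a).wires i = (g b).wires j) → τ a < τ b) :
    DelayLE (l.map g) T := by
  -- Invariant of the induction: the qubits of each remaining gate `b` are free before step `A + τ
  -- b`, so that `b` runs at that step at the latest. Scheduling `a` keeps it, as later gates that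
  -- share a qubit with `a` have larger labels.
  suffices key : ∀ (f : Q → ℕ) (A : ℕ), (∀ q, f q ≤ A + T) →
      (∀ b ∈ l, ∀ i, f ((g b).wires i) < A + τ b) → ∀ q, (l.map g).foldl schedule f q ≤ A + T by
    intro f A hf
    refine key f A (fun q => (hf q).trans (by omega)) fun b hb i => ?_
    have := hf ((g b).wires i)
    have := (hτ b hb).1
    omega
  induction l with
  | nil => exact fun f A hf _ => hf
  | cons a l ih =>
    intro f A hf hb
    rw [List.pairwise_cons] at hl
    rw [List.map_cons, List.foldl_cons]
    have hs : ∀ q, (∃ i, (g a).wires i = q) → schedule f (g a) q ≤ A + τ a := by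
      intro q hq
      rw [schedule, if_pos hq, Nat.succ_le_iff, Finset.sup_lt_iff]
      · exact fun i _ => hb a (by simp) i
      · exact Nat.zero_lt_of_lt (hb a (by simp) hq.choose)
    refine ih (fun b hb => hτ b (List.mem_cons_of_mem _ hb)) hl.2 _ A (fun q => ?_) fun b hbl i => ?_
    · by_cases hq : ∃ i, (g a).wires i = q
      · exact (hs q hq).trans (by have := (hτ a (by simp)).2; omega)
      · rw [schedule, if_neg hq]
        exact hf q
    · by_cases hq : ∃ j, (g a).wires j = (g b).wires i
      · have := hs _ hq
        have := hl.1 b hbl ⟨_, _, hq.choose_spec⟩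
        omega
      · rw [schedule, if_neg hq]
        exact hb b (List.mem_cons_of_mem _ hbl) i

theorem delayLE_length (C : Circuit Q) : DelayLE C C.length := by
  induction C with
  | nil => exact fun f A hf => hf
  | cons g C ih =>
    rw [List.length_cons, add_comm]
    refine DelayLE.append (C := [g]) (T := 1) ?_ ih
    exact delayLE_of_labels (fun _ : Unit => g) (fun _ => 1) 1 [()] (by simp) (by simp)

theorem Circuit.IsElementary.append {C C' : Circuit Q} (h : C.IsElementary)
    (h' : C'.IsElementary) : Circuit.IsElementary (C ++ C') := fun g hg =>
  (List.mem_append.1 hg).elim (h g) (h' g)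

theorem Circuit.isElementary_ofFn {k : ℕ} (g : Fin k → Gate Q)
    (h : ∀ i, Circuit.IsElementary [g i]) : Circuit.IsElementary (List.ofFn g) := by
  intro g' hg
  obtain ⟨i, rfl⟩ := (List.mem_ofFn' _ _).1 hg
  exact h i _ (by simp)

theorem Circuit.isElementary_flatten (l : List (Circuit Q)) (h : ∀ C ∈ l, Circuit.IsElementary C) :
    Circuit.IsElementary l.flatten := by
  intro g hg
  obtain ⟨C, hC, hg⟩ := List.mem_flatten.1 hg
  exact h C hC g hg

theorem isElementary_one (q : Q) {A : Matrix (Fin 2) (Fin 2) ℂ}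
    (hA : A ∈ Matrix.unitaryGroup _ ℂ) : Circuit.IsElementary [Gate.one q A] := by
  intro g hg
  rw [List.mem_singleton.1 hg]
  exact ⟨Or.inl rfl, injective_vec_one q, site_mem_unitaryGroup (0 : Fin 1) hA⟩

theorem isElementary_controlled {c q : Q} (h : q ≠ c) {A : Op (Fin 1)}
    (hA : A ∈ Matrix.unitaryGroup _ ℂ) : Circuit.IsElementary [Gate.controlled c ![q] A] := by
  intro g hg
  rw [List.mem_singleton.1 hg]
  exact ⟨Or.inr rfl, injective_cons (injective_vec_one q) (by simpa using h),
    ctrl_mem_unitaryGroup hA⟩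

theorem Gate.toOp_controlled {k : ℕ} {c : Q} {w : Fin k → Q} (hw : Function.Injective w)
    (hc : ∀ i, w i ≠ c) (A : Op (Fin k)) :
    (Gate.controlled c w A).toOp = controlBy c (onWires w A) :=
  onWires_ctrl hw hc A

theorem controlBy_list_prod {c : Q} (l : List (Op Q)) (hl : ∀ A ∈ l, Preserves c A) :
    controlBy c l.prod = (l.map (controlBy c)).prod := by
  induction l with
  | nil => simpa using controlBy_one c
  | cons A l ih =>
    rw [List.prod_cons, controlBy_mul (hl A (by simp)), List.map_cons, List.prod_cons,
      ih fun B hB => hl B (List.mem_cons_of_mem _ hB)]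

/-- A controlled tensor product, gate by gate. -/
theorem eval_controlled_sites {n : ℕ} {c : Q} {s : Fin n → Q} (hs : Function.Injective s)
    (hc : ∀ i, s i ≠ c) (A : Fin n → Matrix (Fin 2) (Fin 2) ℂ) :
    Circuit.eval (List.ofFn fun k => Gate.controlled c ![s k] (site 0 (A k))) =
      controlBy c (onWires s (tensor A)) := by
  have hg : ∀ k, (Gate.controlled c ![s k] (site 0 (A k))).toOp =
      controlBy c (onWires s (site k (A k))) := by
    intro k
    rw [Gate.toOp_controlled (injective_vec_one _) (by simpa using hc k), onWires_site s hs,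
      ← site_eq_onWires]
  -- The first gate is the rightmost factor, hence the reversed order; a tensor product may be taken
  -- in any order.
  rw [tensor_eq_list_prod A (List.finRange n).reverse
      (List.nodup_reverse.2 (List.nodup_finRange n)) (by simp), onWires_list_prod s hs,
    controlBy_list_prod, Circuit.eval_eq_prod, List.ofFn_eq_map]
  · simp only [List.map_map, List.map_reverse, Function.comp_def, hg]
  · intro B hB
    simp only [List.map_map, List.mem_map] at hB
    obtain ⟨k, -, rfl⟩ := hB
    exact preserves_onWires hc _

end Circuits

/-! ### The circuits for the ansatz -/

section Ansatz

variable {Q : Type} [Fintype Q] [DecidableEq Q]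

theorem site_mul_site_comm {q r : Q} (h : q ≠ r) (A B : Matrix (Fin 2) (Fin 2) ℂ) :
    site q A * site r B = site r B * site q A := by
  rw [site_eq_tensor, site_eq_tensor, ← tensor_mul, ← tensor_mul]
  congr 1
  exact (Pi.mulSingle_commute (f := fun _ : Q => Matrix (Fin 2) (Fin 2) ℂ) h A B).eq

theorem pair_mul_self {q r : Q} (h : q ≠ r) {A B : Matrix (Fin 2) (Fin 2) ℂ} (hA : A * A = 1)
    (hB : B * B = 1) : (site q A * site r B) * (site q A * site r B) = 1 := by
  rw [mul_assoc, ← mul_assoc (site r B), ← site_mul_site_comm h, ← mul_assoc, ← mul_assoc,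
    ← site_mul, hA, site_one, one_mul, ← site_mul, hB, site_one]

theorem pair_conjTranspose {q r : Q} (h : q ≠ r) {A B : Matrix (Fin 2) (Fin 2) ℂ} (hA : Aᴴ = A)
    (hB : Bᴴ = B) : (site q A * site r B)ᴴ = site q A * site r B := by
  rw [Matrix.conjTranspose_mul, site_conjTranspose, site_conjTranspose, hA, hB,
    site_mul_site_comm h]

/-- For involutions the exponential is linear in `1` and `P`, so the linearity of the embedding
suffices. -/
theorem onWires_exp {k : ℕ} {w : Fin k → Q} (hw : Function.Injective w) {P : Op (Fin k)}
    (hP : P * P = 1) (θ : ℂ) : onWires w (NormedSpace.exp ((Complex.I * θ) • P)) =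
      NormedSpace.exp ((Complex.I * θ) • onWires w P) := by
  rw [exp_involution P hP, exp_involution (onWires w P), onWires_add, onWires_smul, onWires_smul,
    onWires_one w hw]
  rw [← onWires_mul w hw, hP, onWires_one w hw]

theorem left_ne_right {n : ℕ} (j : Fin (n - 1)) : left j ≠ right j := by
  simp [left, right, Fin.ext_iff]

/-- The rotations of neighbouring qubits commute with the embedding of the system. -/
theorem onWires_pair_exp {n : ℕ} {s : Fin n → Q} (hs : Function.Injective s) (j : Fin (n - 1))
    {A B : Matrix (Fin 2) (Fin 2) ℂ} (hA : A * A = 1) (hB : B * B = 1) (θ : ℂ) :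
    onWires ![s (left j), s (right j)]
        (NormedSpace.exp ((Complex.I * θ) • (site 0 A * site 1 B : Op (Fin 2)))) =
      onWires s (NormedSpace.exp ((Complex.I * θ) • (site (left j) A * site (right j) B))) := by
  have hw := injective_vec_two (hs.ne (left_ne_right j))
  rw [onWires_exp hw (pair_mul_self (by decide) hA hB),
    onWires_exp hs (pair_mul_self (left_ne_right j) hA hB), onWires_mul _ hw, onWires_mul _ hs,
    onWires_site _ hw, onWires_site _ hw, onWires_site _ hs, onWires_site _ hs]
  rfl

variable {n L : ℕ}

theorem prod_ansatzGates {s : Fin n → Q} (hs : Function.Injective s)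
    (σ : Equiv.Perm (Fin (n - 1))) (αxy αyx : Fin L → Fin (n - 1) → ℝ) :
    ((ansatzGates s σ αxy αyx).map Gate.toOp).prod = onWires s (ansatz σ αxy αyx) := by
  rw [ansatz, onWires_list_prod s hs, ansatzGates, List.map_flatten, List.prod_flatten,
    List.map_ofFn, List.map_ofFn, List.map_ofFn]
  congr 2
  funext l
  simp only [Function.comp_apply, onWires_mul s hs, onWires_list_prod s hs, List.map_append,
    List.prod_append, List.map_ofFn]
  congr 3 <;> funext i <;> simp only [Function.comp_apply, Gate.toOp]
  · exact onWires_pair_exp hs _ sigmaX_mul_self sigmaY_mul_self _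
  · exact onWires_pair_exp hs _ sigmaY_mul_self sigmaX_mul_self _

theorem ansatzGates_neg (s : Fin n → Q) (σ : Equiv.Perm (Fin (n - 1))) (αxy αyx : Fin L → Fin (n - 1) → ℝ) :
    (ansatzGates s σ (-αxy) (-αyx)).map Gate.toOp =
      ((ansatzGates s σ αxy αyx).map Gate.toOp).map Matrix.conjTranspose := by
  simp only [ansatzGates, List.map_flatten, List.map_ofFn]
  congr 2
  funext l
  simp only [Function.comp_apply, List.map_append, List.map_ofFn]
  congr 2 <;> funext i <;> simp only [Function.comp_apply, Gate.toOp]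
  · rw [← onWires_conjTranspose, exp_smul_conjTranspose _
      (pair_conjTranspose (by decide) sigmaX_conjTranspose sigmaY_conjTranspose)]
    rfl
  · rw [← onWires_conjTranspose, exp_smul_conjTranspose _
      (pair_conjTranspose (by decide) sigmaY_conjTranspose sigmaX_conjTranspose)]
    rfl

theorem eval_ansatzCircuit {s : Fin n → Q} (hs : Function.Injective s)
    (σ : Equiv.Perm (Fin (n - 1))) (αxy αyx : Fin L → Fin (n - 1) → ℝ) :
    (ansatzCircuit s σ αxy αyx).eval = onWires s (ansatz σ αxy αyx) := by
  rw [ansatzCircuit, Circuit.eval_eq_prod, List.map_reverse, List.reverse_reverse,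
    prod_ansatzGates hs]

/-- `ansatzGates` lists the factors from left to right, while the first gate of a circuit is the
rightmost factor. Running the list forwards with negated angles thus gives the adjoints in the
opposite order. -/
theorem eval_ansatzDaggerCircuit {s : Fin n → Q} (hs : Function.Injective s)
    (σ : Equiv.Perm (Fin (n - 1))) (αxy αyx : Fin L → Fin (n - 1) → ℝ) :
    (ansatzDaggerCircuit s σ αxy αyx).eval = onWires s (ansatz σ αxy αyx)ᴴ := by
  rw [ansatzDaggerCircuit, Circuit.eval_eq_prod, ansatzGates_neg s,
    ← Matrix.conjTranspose_list_prod, prod_ansatzGates hs, onWires_conjTranspose]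

theorem isElementary_ansatzGates {s : Fin n → Q} (hs : Function.Injective s)
    (σ : Equiv.Perm (Fin (n - 1))) (αxy αyx : Fin L → Fin (n - 1) → ℝ) :
    (ansatzGates s σ αxy αyx).IsElementary := by
  refine Circuit.isElementary_flatten _ fun C hC => ?_
  obtain ⟨l, rfl⟩ := (List.mem_ofFn' _ _).1 hC
  refine (Circuit.isElementary_ofFn _ fun i => ?_).append (Circuit.isElementary_ofFn _ fun i => ?_)
    <;> intro g hg <;> rw [List.mem_singleton.1 hg]
  · exact ⟨Or.inr rfl, injective_vec_two (hs.ne (left_ne_right _)),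
      exp_mem_unitaryGroup _
        (pair_conjTranspose (show (0 : Fin 2) ≠ 1 by decide) sigmaX_conjTranspose sigmaY_conjTranspose) _⟩
  · exact ⟨Or.inr rfl, injective_vec_two (hs.ne (left_ne_right _)),
      exp_mem_unitaryGroup _
        (pair_conjTranspose (show (0 : Fin 2) ≠ 1 by decide) sigmaY_conjTranspose sigmaX_conjTranspose) _⟩

theorem isElementary_ansatzCircuit {s : Fin n → Q} (hs : Function.Injective s)
    (σ : Equiv.Perm (Fin (n - 1))) (αxy αyx : Fin L → Fin (n - 1) → ℝ) :
    (ansatzCircuit s σ αxy αyx).IsElementary := fun g hg =>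
  isElementary_ansatzGates hs σ αxy αyx g (List.mem_reverse.1 hg)

theorem ansatz_mem_unitaryGroup (σ : Equiv.Perm (Fin (n - 1)))
    (αxy αyx : Fin L → Fin (n - 1) → ℝ) : ansatz σ αxy αyx ∈ Matrix.unitaryGroup _ ℂ := by
  refine Submonoid.list_prod_mem _ fun A hA => ?_
  obtain ⟨l, rfl⟩ := (List.mem_ofFn' _ _).1 hA
  refine mul_mem (Submonoid.list_prod_mem _ fun A hA => ?_)
    (Submonoid.list_prod_mem _ fun A hA => ?_) <;> obtain ⟨i, rfl⟩ := (List.mem_ofFn' _ _).1 hA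
  · exact exp_mem_unitaryGroup _
      (pair_conjTranspose (left_ne_right _) sigmaX_conjTranspose sigmaY_conjTranspose) _
  · exact exp_mem_unitaryGroup _
      (pair_conjTranspose (left_ne_right _) sigmaY_conjTranspose sigmaX_conjTranspose) _

/-! ### The depth of the ansatz -/

/-- A height of the neighbouring pairs which changes by one from pair to pair: upwards where the
left pair comes first in the order `σ`, downwards otherwise. -/
def pairHeight (σ : Equiv.Perm (Fin (n - 1))) (j : ℕ) : ℕ :=
  (n - j) + ∑ i ∈ Finset.range j,
    if h : i + 1 < n - 1 then
      if σ.symm ⟨i, by omega⟩ < σ.symm ⟨i + 1, h⟩ then 2 else 0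
    else 0

theorem pairHeight_le (σ : Equiv.Perm (Fin (n - 1))) (j : ℕ) : pairHeight σ j ≤ n + 2 * j := by
  have : (∑ i ∈ Finset.range j, if h : i + 1 < n - 1 then
      if σ.symm ⟨i, by omega⟩ < σ.symm ⟨i + 1, h⟩ then 2 else 0 else 0) ≤
      ∑ i ∈ Finset.range j, 2 :=
    Finset.sum_le_sum fun i _ => by split_ifs <;> omega
  simp only [Finset.sum_const, Finset.card_range, smul_eq_mul] at this
  rw [pairHeight]
  omega

theorem pairHeight_succ (σ : Equiv.Perm (Fin (n - 1))) (j : ℕ) (h : j + 1 < n - 1) :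
    pairHeight σ (j + 1) + 1 = pairHeight σ j +
      if σ.symm ⟨j, by omega⟩ < σ.symm ⟨j + 1, h⟩ then 2 else 0 := by
  rw [pairHeight, pairHeight, Finset.sum_range_succ, dif_pos h]
  split_ifs <;> omega

/-- Gates in different half layers can conflict only on equal or adjacent pairs; the bound `1` makes
a shift by `2` per half layer enough. -/
theorem pairHeight_le_succ (σ : Equiv.Perm (Fin (n - 1))) (i j : Fin (n - 1))
    (hij : (i : ℕ) ≤ j + 1) (hji : (j : ℕ) ≤ i + 1) :
    pairHeight σ i ≤ pairHeight σ j + 1 := by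
  rcases lt_trichotomy (i : ℕ) j with h | h | h
  · have hj : (j : ℕ) = i + 1 := by omega
    have := pairHeight_succ σ i (by omega)
    rw [hj]
    split_ifs at this <;> omega
  · rw [h]; omega
  · have hj : (i : ℕ) = j + 1 := by omega
    have := pairHeight_succ σ j (by omega)
    rw [hj]
    split_ifs at this <;> omega

/-- Within a half layer the height itself orders conflicting gates as `σ` does. -/
theorem pairHeight_lt (σ : Equiv.Perm (Fin (n - 1))) (i j : Fin (n - 1)) (hlt : i < j)
    (hij : (σ i : ℕ) ≤ σ j + 1) (hji : (σ j : ℕ) ≤ σ i + 1) :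
    pairHeight σ (σ i) < pairHeight σ (σ j) := by
  have hne : (σ i : ℕ) ≠ σ j := fun h => hlt.ne (σ.injective (Fin.ext h))
  rcases lt_or_gt_of_ne hne with h | h
  · have hj : (σ j : ℕ) = σ i + 1 := by omega
    have := pairHeight_succ σ (σ i) (by omega)
    rw [if_pos] at this
    · rw [hj]; omega
    · convert hlt
      · simp
      · rw [Equiv.symm_apply_eq]; exact Fin.ext hj.symm
  · have hj : (σ i : ℕ) = σ j + 1 := by omega
    have := pairHeight_succ σ (σ j) (by omega)
    rw [if_neg] at this
    · rw [hj]; omega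
    · rw [not_lt]
      convert hlt.le
      · rw [Equiv.symm_apply_eq]; exact Fin.ext hj.symm
      · simp

/-- Layer, half of the layer, and position of a gate of the ansatz, in the order of the product. -/
def ansatzIndices (L n : ℕ) : List (Fin L × Bool × Fin (n - 1)) :=
  (List.finRange L).flatMap fun l =>
    (List.finRange (n - 1)).map (fun i => (l, false, i)) ++
      (List.finRange (n - 1)).map (fun i => (l, true, i))

noncomputable def ansatzGate (s : Fin n → Q) (σ : Equiv.Perm (Fin (n - 1)))
    (αxy αyx : Fin L → Fin (n - 1) → ℝ) (a : Fin L × Bool × Fin (n - 1)) : Gate Q :=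
  ⟨2, ![s (left (σ a.2.2)), s (right (σ a.2.2))],
    if a.2.1 then NormedSpace.exp ((Complex.I * αyx a.1 (σ a.2.2)) •
      (site 0 sigmaY * site 1 sigmaX : Op (Fin 2)))
    else NormedSpace.exp ((Complex.I * αxy a.1 (σ a.2.2)) •
      (site 0 sigmaX * site 1 sigmaY : Op (Fin 2)))⟩

theorem ansatzGates_eq_map (s : Fin n → Q) (σ : Equiv.Perm (Fin (n - 1)))
    (αxy αyx : Fin L → Fin (n - 1) → ℝ) :
    ansatzGates s σ αxy αyx = (ansatzIndices L n).map (ansatzGate s σ αxy αyx) := by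
  rw [ansatzGates, ansatzIndices, List.flatMap, List.map_flatten, List.map_map, List.ofFn_eq_map]
  simp only [Function.comp_def, List.map_append, List.map_map, List.ofFn_eq_map]
  rfl

/-- A time step at which the gate may run: half layers start two steps apart although each takes up
to order `n` steps. The final `1` is there because steps are counted from `1`. -/
def ansatzLabel (σ : Equiv.Perm (Fin (n - 1))) (a : Fin L × Bool × Fin (n - 1)) : ℕ :=
  4 * a.1 + (if a.2.1 then 2 else 0) + pairHeight σ (σ a.2.2) + 1

theorem ansatzLabel_le (σ : Equiv.Perm (Fin (n - 1))) (a : Fin L × Bool × Fin (n - 1)) :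
    ansatzLabel σ a ≤ 4 * L + 3 * n := by
  have h₁ := a.1.2
  have h₂ := (σ a.2.2).2
  have h₃ := pairHeight_le σ (σ a.2.2)
  rw [ansatzLabel]
  split_ifs <;> omega

theorem pairwise_ansatzLabel {s : Fin n → Q} (hs : Function.Injective s)
    (σ : Equiv.Perm (Fin (n - 1))) (αxy αyx : Fin L → Fin (n - 1) → ℝ) :
    (ansatzIndices L n).Pairwise fun a b =>
      (∃ i j, (ansatzGate s σ αxy αyx a).wires i = (ansatzGate s σ αxy αyx b).wires j) →
        ansatzLabel σ a < ansatzLabel σ b := by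
  -- Gates that share a qubit belong to the same pair or to adjacent pairs.
  have near : ∀ a b : Fin L × Bool × Fin (n - 1),
      (∃ i j, (ansatzGate s σ αxy αyx a).wires i = (ansatzGate s σ αxy αyx b).wires j) →
        ((σ a.2.2 : ℕ) ≤ σ b.2.2 + 1 ∧ (σ b.2.2 : ℕ) ≤ σ a.2.2 + 1) := by
    rintro a b ⟨i, j, h⟩
    change Fin 2 at i
    change Fin 2 at j
    change (![s (left (σ a.2.2)), s (right (σ a.2.2))] : Fin 2 → Q) i =
      (![s (left (σ b.2.2)), s (right (σ b.2.2))] : Fin 2 → Q) j at h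
    fin_cases i <;> fin_cases j <;>
      · have h := congrArg Fin.val (hs h)
        simp only [left, right] at h
        omega
  have same : ∀ (l : Fin L) (b : Bool),
      ((List.finRange (n - 1)).map (fun i => (l, b, i))).Pairwise fun a b =>
        (∃ i j, (ansatzGate s σ αxy αyx a).wires i = (ansatzGate s σ αxy αyx b).wires j) →
          ansatzLabel σ a < ansatzLabel σ b := by
    intro l b
    rw [List.pairwise_map]
    refine (List.pairwise_lt_finRange (n - 1)).imp fun {i j} hij h => ?_
    obtain ⟨h₁, h₂⟩ := near _ _ h
    have := pairHeight_lt σ i j hij h₁ h₂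
    simp only [ansatzLabel]
    omega
  rw [ansatzIndices, List.pairwise_flatMap]
  constructor
  · intro l _
    rw [List.pairwise_append]
    refine ⟨same l false, same l true, fun a ha b hb h => ?_⟩
    obtain ⟨i, -, rfl⟩ := List.mem_map.1 ha
    obtain ⟨j, -, rfl⟩ := List.mem_map.1 hb
    obtain ⟨h₁, h₂⟩ := near _ _ h
    have := pairHeight_le_succ σ _ _ h₁ h₂
    simp only [ansatzLabel, Bool.false_eq_true, if_true, if_false]
    dsimp only at this
    omega
  · refine (List.pairwise_lt_finRange L).imp fun {l l'} hl a ha b hb h => ?_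
    obtain ⟨h₁, h₂⟩ := near _ _ h
    have := pairHeight_le_succ σ _ _ h₁ h₂
    have ha : a.1 = l := by
      simp only [List.mem_append, List.mem_map] at ha
      rcases ha with ⟨i, -, rfl⟩ | ⟨i, -, rfl⟩ <;> rfl
    have hb : b.1 = l' := by
      simp only [List.mem_append, List.mem_map] at hb
      rcases hb with ⟨i, -, rfl⟩ | ⟨i, -, rfl⟩ <;> rfl
    have hl : (l : ℕ) < l' := hl
    simp only [ansatzLabel, ha, hb]
    split_ifs <;> omega

theorem delayLE_ansatzGates {s : Fin n → Q} (hs : Function.Injective s)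
    (σ : Equiv.Perm (Fin (n - 1))) (αxy αyx : Fin L → Fin (n - 1) → ℝ) :
    DelayLE (ansatzGates s σ αxy αyx) (4 * L + 3 * n) := by
  rw [ansatzGates_eq_map]
  exact delayLE_of_labels _ (ansatzLabel σ) _ _
    (fun a _ => ⟨Nat.le_add_left _ _, ansatzLabel_le σ a⟩) (pairwise_ansatzLabel hs σ αxy αyx)

theorem delayLE_ansatzCircuit {s : Fin n → Q} (hs : Function.Injective s)
    (σ : Equiv.Perm (Fin (n - 1))) (αxy αyx : Fin L → Fin (n - 1) → ℝ) :
    DelayLE (ansatzCircuit s σ αxy αyx) (4 * L + 3 * n) := by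
  rw [ansatzCircuit, ansatzGates_eq_map, ← List.map_reverse]
  -- Time reversal: reflecting the labels keeps them in the range from `1` to `4 * L + 3 * n`.
  refine delayLE_of_labels _ (fun a => 4 * L + 3 * n + 1 - ansatzLabel σ a) _ _ (fun a _ => ?_) ?_
  · have := ansatzLabel_le σ a
    have : 1 ≤ ansatzLabel σ a := Nat.le_add_left _ _
    omega
  · rw [List.pairwise_reverse]
    refine (pairwise_ansatzLabel hs σ αxy αyx).imp fun {a b} h ⟨i, j, hij⟩ => ?_
    have := h ⟨j, i, hij.symm⟩
    have := ansatzLabel_le σ b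
    omega

end Ansatz

/-! ### The diagonalized evolution -/

section Diagonalization

variable {n L : ℕ}

open scoped ComplexOrder in
theorem cost_eq_zero_iff (H W D : Op (Fin n)) : cost H W D = 0 ↔ H = W * D * Wᴴ := by
  constructor
  · intro h
    rw [cost, div_eq_zero_iff, or_iff_left (by positivity)] at h
    -- `cost` sees only the real part of the trace; the trace is real, so it vanishes altogether.
    have him : ∀ A : Op (Fin n), (Aᴴ * A).trace.im = 0 := by
      intro A
      rw [← Complex.conj_eq_iff_im]
      change star _ = _
      rw [← Matrix.trace_conjTranspose, Matrix.conjTranspose_mul, Matrix.conjTranspose_conjTranspose]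
    exact sub_eq_zero.1 (Matrix.trace_conjTranspose_mul_self_eq_zero_iff.1
      (Complex.ext h (him _)))
  · intro h
    rw [cost, sub_eq_zero.2 h]
    simp

theorem evolution_conj {W : Op (Fin n)} (hW : W ∈ Matrix.unitaryGroup _ ℂ) (D : Op (Fin n))
    (t : ℝ) : evolution (W * D * Wᴴ) t = W * evolution D t * Wᴴ := by
  have h₁ := Matrix.mem_unitaryGroup_iff.1 hW
  have hinv : W⁻¹ = Wᴴ := Matrix.inv_eq_right_inv h₁
  have hu : IsUnit W := (Matrix.isUnit_iff_isUnit_det W).2 (Matrix.isUnit_det_of_right_inverse h₁)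
  rw [evolution, evolution, ← hinv, ← Matrix.exp_conj _ _ hu]
  congr 1
  simp

theorem evolution_add (H : Op (Fin n)) (t t' : ℝ) :
    evolution H (t + t') = evolution H t * evolution H t' := by
  rw [evolution, evolution, evolution, ← Matrix.exp_add_of_commute]
  · congr 1
    push_cast
    module
  · exact (Commute.refl H).smul_left _ |>.smul_right _

/-- The eigenvalues of the Pauli matrix `Z`. -/
def signZ (b : Fin 2) : ℂ := if b = 0 then 1 else -1

theorem sigmaZ_eq_diagonal : sigmaZ = Matrix.diagonal signZ := by
  ext i j; fin_cases i <;> fin_cases j <;> simp [sigmaZ, signZ]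

/-- The rotation `e^{-iφZ}`. -/
noncomputable def rotationZ (φ : ℝ) : Matrix (Fin 2) (Fin 2) ℂ :=
  Matrix.diagonal fun b => Complex.exp (-Complex.I * φ * signZ b)

theorem exp_diagonal_complex {d : Type} [Fintype d] [DecidableEq d] (v : d → ℂ) :
    NormedSpace.exp (Matrix.diagonal v) = Matrix.diagonal fun x => Complex.exp (v x) := by
  rw [Matrix.exp_diagonal]
  congr 1
  funext x
  rw [Pi.coe_exp, Complex.exp_eq_exp_ℂ]

theorem rotationZ_mem_unitaryGroup (φ : ℝ) : rotationZ φ ∈ Matrix.unitaryGroup _ ℂ := by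
  have h := diagonal_exp_mem_unitaryGroup fun b : Fin 2 => φ * if b = 0 then 1 else -1
  convert h using 1
  rw [rotationZ]
  congr 1
  funext b
  rw [signZ]
  split_ifs <;> simp

theorem exp_site_sigmaZ (φ : ℝ) :
    NormedSpace.exp ((-Complex.I * φ) • (site 0 sigmaZ : Op (Fin 1))) =
      site 0 (rotationZ φ) := by
  rw [sigmaZ_eq_diagonal, site_diagonal, ← Matrix.diagonal_smul, exp_diagonal_complex, rotationZ,
    site_diagonal]
  rfl

/-- `D(β)` is diagonal with eigenvalues that are sums over the qubits, so its exponential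
factorizes. -/
theorem evolution_diagAnsatz (β : Fin n → ℝ) (t : ℝ) :
    evolution (diagAnsatz β) t = tensor fun k => rotationZ (β k * t) := by
  have h : diagAnsatz β = Matrix.diagonal fun x => ∑ k, (β k : ℂ) * signZ (x k) := by
    simp only [diagAnsatz, sigmaZ_eq_diagonal, site_diagonal]
    ext x y
    simp only [Matrix.sum_apply, Matrix.smul_apply, Matrix.diagonal_apply, smul_eq_mul]
    split_ifs <;> simp
  rw [h, evolution, ← Matrix.diagonal_smul, exp_diagonal_complex]
  simp only [rotationZ]
  rw [tensor_diagonal]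
  congr 1
  funext x
  rw [← Complex.exp_sum, Pi.smul_apply, smul_eq_mul, Finset.mul_sum]
  congr 1
  refine Finset.sum_congr rfl fun k _ => ?_
  push_cast
  ring

/-- The inner factors `b * a` cancel; `a * b = 1` serves the empty product. -/
theorem list_prod_conj {ι M : Type} [Monoid M] {a b : M} (hab : a * b = 1) (hba : b * a = 1)
    (f : ι → M) (l : List ι) :
    (l.map fun i => a * f i * b).prod = a * (l.map f).prod * b := by
  induction l with
  | nil => simp [hab]
  | cons i l ih =>
    simp only [List.map_cons, List.prod_cons, ih]
    calc a * f i * b * (a * (l.map f).prod * b)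
        = a * f i * (b * a) * (l.map f).prod * b := by simp only [mul_assoc]
      _ = a * (f i * (l.map f).prod) * b := by rw [hba, mul_one]; simp only [mul_assoc]

variable {Q : Type} [Fintype Q] [DecidableEq Q] {m : ℕ}

theorem eval_evolutionBlock {c : Fin m → Q} {s : Fin n → Q} (hs : Function.Injective s)
    (hc : ∀ j i, s i ≠ c j) (H : Op (Fin n)) (ε : ℝ) :
    (evolutionBlock c s H ε).eval = ((List.finRange m).reverse.map fun j =>
      controlBy (c j) (onWires s (evolution H (2 ^ (j : ℕ) * ε)))).prod := by
  rw [evolutionBlock, Circuit.eval_eq_prod, List.ofFn_eq_map, List.map_map, List.map_reverse]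
  simp only [Function.comp_def, Gate.toOp_controlled hs (hc _)]

theorem eval_diagonalBlock {c : Fin m → Q} {s : Fin n → Q} (hs : Function.Injective s)
    (hc : ∀ j i, s i ≠ c j) {H : Op (Fin n)} {σ : Equiv.Perm (Fin (n - 1))}
    {αxy αyx : Fin L → Fin (n - 1) → ℝ} {β : Fin n → ℝ} (h : Trained H σ αxy αyx β) (ε : ℝ) :
    (diagonalBlock c s σ αxy αyx β ε).eval = (evolutionBlock c s H ε).eval := by
  have hW := ansatz_mem_unitaryGroup σ αxy αyx
  have hW₁ := Matrix.mem_unitaryGroup_iff.1 hW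
  have hW₂ := Matrix.mem_unitaryGroup_iff'.1 hW
  rw [Matrix.star_eq_conjTranspose] at hW₁ hW₂
  have hs₁ : onWires s (ansatz σ αxy αyx) * onWires s (ansatz σ αxy αyx)ᴴ = 1 := by
    rw [← onWires_mul s hs, hW₁, onWires_one s hs]
  have hs₂ : onWires s (ansatz σ αxy αyx)ᴴ * onWires s (ansatz σ αxy αyx) = 1 := by
    rw [← onWires_mul s hs, hW₂, onWires_one s hs]
  have hrot : ∀ j : Fin m, Circuit.eval (List.ofFn fun k : Fin n => Gate.controlled (c j) ![s k]
        (NormedSpace.exp ((-Complex.I * (β k * (2 ^ (j : ℕ) * ε))) •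
          (site 0 sigmaZ : Op (Fin 1))))) =
      controlBy (c j) (onWires s (evolution (diagAnsatz β) (2 ^ (j : ℕ) * ε))) := by
    intro j
    rw [evolution_diagAnsatz, ← eval_controlled_sites hs (hc j)]
    congr 2
    funext k
    rw [← exp_site_sigmaZ]
    push_cast
    rfl
  rw [diagonalBlock, Circuit.eval_append, Circuit.eval_append, eval_ansatzCircuit hs,
    eval_ansatzDaggerCircuit hs, Circuit.eval_flatten, List.ofFn_eq_map, List.map_map,
    ← List.map_reverse, eval_evolutionBlock hs hc, (cost_eq_zero_iff _ _ _).1 h, ← mul_assoc]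
  simp only [Function.comp_def, hrot]
  -- The outer `W` and `W†` are distributed over the clock qubits, so that each factor becomes one
  -- controlled evolution.
  rw [← list_prod_conj hs₁ hs₂]
  congr 2
  funext j
  rw [evolution_conj hW, onWires_mul s hs, onWires_mul s hs,
    controlBy_conj (preserves_onWires (hc j) _) _ _ hs₁]

theorem delayLE_flatten {k d : ℕ} (C : Fin k → Circuit Q) (h : ∀ j, (C j).length = d) :
    DelayLE (List.ofFn C).flatten (k * d) := by
  refine (delayLE_length _).mono (le_of_eq ?_)
  simp [List.length_flatten, List.map_ofFn, Function.comp_def, h]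

/-- The `m * n` controlled rotations are counted one after another; no parallelism among them is
needed. -/
theorem delayLE_diagonalBlock (c : Fin m → Q) {s : Fin n → Q} (hs : Function.Injective s)
    (σ : Equiv.Perm (Fin (n - 1))) (αxy αyx : Fin L → Fin (n - 1) → ℝ) (β : Fin n → ℝ) (ε : ℝ) :
    DelayLE (diagonalBlock c s σ αxy αyx β ε) (8 * L + 6 * n + m * n) :=
  (((delayLE_ansatzGates hs σ (-αxy) (-αyx)).append
    (delayLE_flatten _ fun _ => List.length_ofFn)).append
      (delayLE_ansatzCircuit hs σ αxy αyx)).mono (by omega)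

theorem isElementary_diagonalBlock {c : Fin m → Q} {s : Fin n → Q} (hs : Function.Injective s)
    (hc : ∀ j i, s i ≠ c j) (σ : Equiv.Perm (Fin (n - 1)))
    (αxy αyx : Fin L → Fin (n - 1) → ℝ) (β : Fin n → ℝ) (ε : ℝ) :
    (diagonalBlock c s σ αxy αyx β ε).IsElementary := by
  refine ((isElementary_ansatzGates hs σ (-αxy) (-αyx)).append
    (Circuit.isElementary_flatten _ fun C hC => ?_)).append
      (isElementary_ansatzCircuit hs σ αxy αyx)
  obtain ⟨j, rfl⟩ := (List.mem_ofFn' _ _).1 hC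
  refine Circuit.isElementary_ofFn _ fun k => isElementary_controlled (hc j k) ?_
  have := site_mem_unitaryGroup (0 : Fin 1) (rotationZ_mem_unitaryGroup (β k * (2 ^ (j : ℕ) * ε)))
  rw [← exp_site_sigmaZ] at this
  push_cast at this
  exact this

theorem delayLE_ofFn {k : ℕ} (g : Fin k → Gate Q) : DelayLE (List.ofFn g) k :=
  (delayLE_length _).mono List.length_ofFn.le

theorem isElementary_hadamards (c : Fin m → Q) : (hadamards c).IsElementary :=
  Circuit.isElementary_ofFn _ fun j => isElementary_one (c j) hadamard_mem_unitaryGroup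

theorem isElementary_overlapBlock {a b : Fin m → Q} (h : ∀ j, b j ≠ a j) :
    (overlapBlock a b).IsElementary := by
  refine Circuit.isElementary_flatten _ fun C hC => ?_
  obtain ⟨j, rfl⟩ := (List.mem_ofFn' _ _).1 hC
  exact Circuit.IsElementary.append (C := [Gate.cnot (a j) (b j)])
    (isElementary_controlled (h j) (site_mem_unitaryGroup (0 : Fin 1)
      (mem_unitaryGroup_of_mul_self sigmaX_mul_self sigmaX_conjTranspose)))
    (isElementary_one (a j) hadamard_mem_unitaryGroup)

theorem delayLE_overlapBlock (a b : Fin m → Q) : DelayLE (overlapBlock a b) (m * 2) :=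
  delayLE_flatten _ fun _ => rfl

theorem eval_controlledPauliSplit {a : Q} {s : Fin n → Q} (hs : Function.Injective s)
    (ha : ∀ i, s i ≠ a) (P : Fin n → Pauli) :
    (controlledPauliSplit a s P).eval = (controlledPauli a s P).eval := by
  rw [controlledPauliSplit, eval_controlled_sites hs ha fun k => (P k).mat, controlledPauli,
    Circuit.eval_eq_prod, List.map_singleton, List.reverse_singleton, List.prod_singleton,
    Gate.toOp_controlled hs ha]
  rfl

theorem isElementary_controlledPauliSplit {a : Q} {s : Fin n → Q} (ha : ∀ i, s i ≠ a)
    (P : Fin n → Pauli) : (controlledPauliSplit a s P).IsElementary :=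
  Circuit.isElementary_ofFn _ fun k => isElementary_controlled (ha k)
    (site_mem_unitaryGroup (0 : Fin 1) (P k).mat_mem_unitaryGroup)

end Diagonalization

/-! ### The history state -/

section History

variable {m n : ℕ}

/-- A system operator acts separately on each slice with a fixed clock value. -/
theorem onWires_inr_mulVec (A : Op (Fin n)) (v : (RegH m n → Fin 2) → ℂ) (x : RegH m n → Fin 2) :
    (onWires Sum.inr A *ᵥ v) x =
      (A *ᵥ fun u => v (Sum.elim (fun j => x (Sum.inl j)) u)) fun k => x (Sum.inr k) := by
  simp only [Matrix.mulVec, dotProduct]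
  rw [← (Equiv.sumArrowEquivProdArrow (Fin m) (Fin n) (Fin 2)).symm.sum_comp,
    Fintype.sum_prod_type, Finset.sum_eq_single fun j => x (Sum.inl j)]
  · refine Finset.sum_congr rfl fun u _ => ?_
    simp [onWires, Equiv.sumArrowEquivProdArrow]
  · intro p _ hp
    refine Finset.sum_eq_zero fun u _ => ?_
    have : ¬ ∀ j, x (Sum.inl j) = p j := fun h => hp (funext fun j => (h j).symm)
    simp [onWires, Equiv.sumArrowEquivProdArrow, this]
  · simp

theorem controlBy_mulVec {Q : Type} [Fintype Q] [DecidableEq Q] (c : Q) (B : Op Q)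
    (v : (Q → Fin 2) → ℂ) (x : Q → Fin 2) :
    (controlBy c B *ᵥ v) x = if x c = 1 then (B *ᵥ v) x else v x := by
  simp only [Matrix.mulVec, dotProduct, controlBy_apply]
  split_ifs
  · rfl
  · simp [Matrix.one_apply]

theorem eval_hadamards_mulVec (ψ₀ : (Fin n → Fin 2) → ℂ) (x : RegH m n → Fin 2) :
    (Circuit.eval (hadamards Sum.inl) *ᵥ initialState (m := m) ψ₀) x =
      ((1 / Real.sqrt (2 ^ m) : ℝ) : ℂ) * ψ₀ fun k => x (Sum.inr k) := by
  have h : Circuit.eval (hadamards (Sum.inl : Fin m → RegH m n)) =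
      tensor (Sum.elim (fun _ => hadamard) fun _ => 1) := by
    have := list_prod_site (fun _ : RegH m n => hadamard)
      (((List.finRange m).map Sum.inl).reverse)
      (List.nodup_reverse.2 ((List.nodup_finRange m).map Sum.inl_injective))
    rw [hadamards, Circuit.eval_eq_prod, List.ofFn_eq_map, List.map_map]
    rw [List.map_reverse, List.map_map] at this
    convert this using 4
    · funext j
      exact (site_eq_onWires _ _).symm
    · rename_i q
      rcases q with j | k <;> simp
  -- Only the basis state with the clock at zero and the system as in `x` contributes; each clock
  -- qubit gives a factor `1/√2`.
  rw [h, Matrix.mulVec, dotProduct,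
    Finset.sum_eq_single (Sum.elim (fun _ => 0) fun k => x (Sum.inr k))]
  · simp only [tensor, Matrix.of_apply, Fintype.prod_sum_type, Sum.elim_inl, Sum.elim_inr,
      initialState]
    have h0 : ∀ b : Fin 2, hadamard b 0 = ((1 / Real.sqrt 2 : ℝ) : ℂ) := by
      intro b
      fin_cases b <;> simp [hadamard]
    simp only [h0, implies_true, if_true, Finset.prod_const, Finset.card_univ, Fintype.card_fin]
    have h1 : ∏ k : Fin n, (1 : Matrix (Fin 2) (Fin 2) ℂ) (x (Sum.inr k)) (x (Sum.inr k)) = 1 :=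
      Finset.prod_eq_one fun k _ => Matrix.one_apply_eq _
    refine (congrArg (fun z => _ * z * _) h1).trans ?_
    rw [mul_one]
    congr 1
    rw [← Complex.ofReal_pow, div_pow, one_pow, Real.sqrt_eq_rpow, Real.sqrt_eq_rpow,
      ← Real.rpow_natCast, ← Real.rpow_natCast, ← Real.rpow_mul (by norm_num),
      ← Real.rpow_mul (by norm_num), mul_comm]
  · intro y _ hy
    rw [initialState]
    split_ifs with h₀
    · have : ∃ k, x (Sum.inr k) ≠ y (Sum.inr k) := by
        by_contra! hk
        exact hy (funext fun q => by rcases q with j | k <;> simp [h₀, hk])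
      obtain ⟨k, hk⟩ := this
      rw [tensor, Matrix.of_apply, Finset.prod_eq_zero (Finset.mem_univ (Sum.inr k)), zero_mul]
      exact Matrix.one_apply_ne hk
    · rw [mul_zero]
  · simp

theorem eval_historyCircuit_mulVec (H : Op (Fin n)) (ε : ℝ) (ψ₀ : (Fin n → Fin 2) → ℂ) :
    (historyCircuit (m := m) (evolutionBlock Sum.inl Sum.inr H ε)).eval *ᵥ initialState ψ₀ =
      historyState H ε ψ₀ := by
  -- For the induction, only the clock qubits in `l` have acted: each one that is set adds its
  -- binary weight to the elapsed time, by `evolution_add`.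
  have key : ∀ (l : List (Fin m)) (x : RegH m n → Fin 2),
      ((l.map fun j => controlBy (Sum.inl j : RegH m n)
          (onWires Sum.inr (evolution H (2 ^ (j : ℕ) * ε)))).prod *ᵥ
        (Circuit.eval (hadamards Sum.inl) *ᵥ initialState (m := m) ψ₀)) x =
      ((1 / Real.sqrt (2 ^ m) : ℝ) : ℂ) * (evolution H
        (ε * ((l.map fun j => (x (Sum.inl j) : ℕ) * 2 ^ (j : ℕ)).sum : ℕ)) *ᵥ ψ₀)
          fun k => x (Sum.inr k) := by
    intro l
    induction l with
    | nil =>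
      intro x
      rw [List.map_nil, List.prod_nil, Matrix.one_mulVec, eval_hadamards_mulVec]
      simp [evolution]
    | cons j l ih =>
      intro x
      rw [List.map_cons, List.prod_cons, ← Matrix.mulVec_mulVec, controlBy_mulVec]
      split_ifs with hx
      · rw [onWires_inr_mulVec]
        simp only [ih, Sum.elim_inl, Sum.elim_inr, List.map_cons, List.sum_cons, hx]
        have : ε * (((1 : Fin 2) : ℕ) * 2 ^ (j : ℕ) +
              (l.map fun j => (x (Sum.inl j) : ℕ) * 2 ^ (j : ℕ)).sum : ℕ) = 2 ^ (j : ℕ) * ε +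
            ε * ((l.map fun j => (x (Sum.inl j) : ℕ) * 2 ^ (j : ℕ)).sum : ℕ) := by
          push_cast
          simp
          ring
        rw [this, evolution_add, ← Matrix.mulVec_mulVec]
        exact congrFun (Matrix.mulVec_smul (evolution H (2 ^ (j : ℕ) * ε))
          ((1 / Real.sqrt (2 ^ m) : ℝ) : ℂ) _) _
      · have hx : x (Sum.inl j) = 0 := by omega
        rw [ih]
        simp [hx]
  rw [historyCircuit, Circuit.eval_append, ← Matrix.mulVec_mulVec,
    eval_evolutionBlock Sum.inr_injective (fun _ _ => Sum.inr_ne_inl)]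
  funext x
  rw [key, List.map_reverse, List.sum_reverse, ← List.ofFn_eq_map, List.sum_ofFn]
  rfl

end History

/-! ### The protocols -/

section Implementations

variable {m n L c : ℕ} {H : Op (Fin n)} {σ : Equiv.Perm (Fin (n - 1))}
  {αxy αyx : Fin L → Fin (n - 1) → ℝ} {β : Fin n → ℝ}

theorem diagonal_depth_bound (hm : 1 ≤ m) (hL : L ≤ c * n) :
    8 * L + 6 * n + m * n ≤ (8 * c + 7) * (m * n) := by
  have h₁ : n ≤ m * n := Nat.le_mul_of_pos_left n hm
  have h₂ : c * n ≤ c * (m * n) := Nat.mul_le_mul_left c h₁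
  have h₃ : (8 * c + 7) * (m * n) = 8 * (c * (m * n)) + 7 * (m * n) := by ring
  omega

/-- The constant `16 * c + 30` is common to all protocols. The overlap circuit for the entropy has
two diagonal blocks, each within `(8 * c + 7) * (m * n)` and here counted sequentially; the other
gates cost `O(m + n)` steps, which `m, n ≥ 1` turns into `O(m n)`. -/
theorem historyCircuit_implements (hn : 1 ≤ n) (hm : 1 ≤ m) (hL : L ≤ c * n)
    (h : Trained H σ αxy αyx β) (ε : ℝ) :
    (historyCircuit (m := m) (diagonalBlock Sum.inl Sum.inr σ αxy αyx β ε)).Implements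
      (historyCircuit (evolutionBlock Sum.inl Sum.inr H ε)) ((16 * c + 30) * (m * n)) := by
  have hs : Function.Injective (Sum.inr : Fin n → RegH m n) := Sum.inr_injective
  have hc : ∀ (j : Fin m) (i : Fin n), (Sum.inr i : RegH m n) ≠ Sum.inl j :=
    fun _ _ => Sum.inr_ne_inl
  refine ⟨(isElementary_hadamards _).append (isElementary_diagonalBlock hs hc _ _ _ _ _), ?_,
    (((delayLE_ofFn _).append (delayLE_diagonalBlock _ hs _ _ _ _ _)).mono ?_).depth_le⟩
  · rw [historyCircuit, historyCircuit, Circuit.eval_append, Circuit.eval_append,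
      eval_diagonalBlock hs hc h]
  · have := diagonal_depth_bound hm hL
    have := Nat.le_mul_of_pos_right m hn
    nlinarith

theorem entropyRandomCircuit_implements (hn : 1 ≤ n) (hm : 1 ≤ m) (hL : L ≤ c * n)
    (h : Trained H σ αxy αyx β) (ε : ℝ) (u : Fin m → Matrix.unitaryGroup (Fin 2) ℂ) :
    (entropyRandomCircuit (diagonalBlock Sum.inl Sum.inr σ αxy αyx β ε) u).Implements
      (entropyRandomCircuit (evolutionBlock Sum.inl Sum.inr H ε) u)
      ((16 * c + 30) * (m * n)) := by
  have hs : Function.Injective (Sum.inr : Fin n → RegH m n) := Sum.inr_injective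
  have hc : ∀ (j : Fin m) (i : Fin n), (Sum.inr i : RegH m n) ≠ Sum.inl j :=
    fun _ _ => Sum.inr_ne_inl
  refine ⟨((isElementary_hadamards _).append (isElementary_diagonalBlock hs hc _ _ _ _ _)).append
      (Circuit.isElementary_ofFn _ fun j => isElementary_one _ (u j).2), ?_,
    ((((delayLE_ofFn _).append (delayLE_diagonalBlock _ hs _ _ _ _ _)).append
      (delayLE_ofFn _)).mono ?_).depth_le⟩
  · simp only [entropyRandomCircuit, Circuit.eval_append, eval_diagonalBlock hs hc h]
  · have := diagonal_depth_bound hm hL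
    have := Nat.le_mul_of_pos_right m hn
    nlinarith

theorem loschmidtCircuit_implements (hn : 1 ≤ n) (hm : 1 ≤ m) (hL : L ≤ c * n)
    (h : Trained H σ αxy αyx β) (ε : ℝ) :
    (loschmidtCircuit (m := m)
        (diagonalBlock Sum.inl (fun k => Sum.inr (Sum.inl k)) σ αxy αyx β ε)).Implements
      (loschmidtCircuit (evolutionBlock Sum.inl (fun k => Sum.inr (Sum.inl k)) H ε))
      ((16 * c + 30) * (m * n)) := by
  have hs : Function.Injective (fun k => Sum.inr (Sum.inl k) : Fin n → RegL m n) :=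
    Sum.inr_injective.comp Sum.inl_injective
  have hc : ∀ (j : Fin m) (i : Fin n), (Sum.inr (Sum.inl i) : RegL m n) ≠ Sum.inl j :=
    fun _ _ => Sum.inr_ne_inl
  refine ⟨((isElementary_hadamards _).append (isElementary_diagonalBlock hs hc _ _ _ _ _)).append
      (isElementary_overlapBlock fun j => ?_), ?_,
    ((((delayLE_ofFn _).append (delayLE_diagonalBlock _ hs _ _ _ _ _)).append
      (delayLE_overlapBlock _ _)).mono ?_).depth_le⟩
  · exact Sum.inr_injective.ne Sum.inr_ne_inl
  · simp only [loschmidtCircuit, Circuit.eval_append, eval_diagonalBlock hs hc h]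
  · have := diagonal_depth_bound hm hL
    have := Nat.le_mul_of_pos_right m hn
    have := Nat.le_mul_of_pos_left n hm
    nlinarith

theorem entropyOverlapCircuit_implements (hn : 1 ≤ n) (hm : 1 ≤ m) (hL : L ≤ c * n)
    (h : Trained H σ αxy αyx β) (ε : ℝ) :
    (entropyOverlapCircuit (m := m)
        (diagonalBlock (fun j => Sum.inl (Sum.inl j)) (fun k => Sum.inl (Sum.inr k))
          σ αxy αyx β ε)
        (diagonalBlock (fun j => Sum.inr (Sum.inl j)) (fun k => Sum.inr (Sum.inr k))
          σ αxy αyx β ε)).Implements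
      (entropyOverlapCircuit
        (evolutionBlock (fun j => Sum.inl (Sum.inl j)) (fun k => Sum.inl (Sum.inr k)) H ε)
        (evolutionBlock (fun j => Sum.inr (Sum.inl j)) (fun k => Sum.inr (Sum.inr k)) H ε))
      ((16 * c + 30) * (m * n)) := by
  have hs₁ : Function.Injective (fun k => Sum.inl (Sum.inr k) : Fin n → RegE m n) :=
    Sum.inl_injective.comp Sum.inr_injective
  have hs₂ : Function.Injective (fun k => Sum.inr (Sum.inr k) : Fin n → RegE m n) :=
    Sum.inr_injective.comp Sum.inr_injective
  have hc₁ : ∀ (j : Fin m) (i : Fin n),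
      (Sum.inl (Sum.inr i) : RegE m n) ≠ Sum.inl (Sum.inl j) :=
    fun _ _ => Sum.inl_injective.ne Sum.inr_ne_inl
  have hc₂ : ∀ (j : Fin m) (i : Fin n),
      (Sum.inr (Sum.inr i) : RegE m n) ≠ Sum.inr (Sum.inl j) :=
    fun _ _ => Sum.inr_injective.ne Sum.inr_ne_inl
  refine ⟨(((isElementary_hadamards _).append
      (isElementary_diagonalBlock hs₁ hc₁ _ _ _ _ _)).append
        ((isElementary_hadamards _).append
          (isElementary_diagonalBlock hs₂ hc₂ _ _ _ _ _))).append
      (isElementary_overlapBlock fun j => Sum.inr_ne_inl), ?_,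
    (((((delayLE_ofFn _).append (delayLE_diagonalBlock _ hs₁ _ _ _ _ _)).append
      ((delayLE_ofFn _).append (delayLE_diagonalBlock _ hs₂ _ _ _ _ _))).append
      (delayLE_overlapBlock _ _)).mono ?_).depth_le⟩
  · simp only [entropyOverlapCircuit, Circuit.eval_append, eval_diagonalBlock hs₁ hc₁ h,
      eval_diagonalBlock hs₂ hc₂ h]
  · have := diagonal_depth_bound hm hL
    have := Nat.le_mul_of_pos_right m hn
    nlinarith

theorem correlationCircuit_implements (hn : 1 ≤ n) (hm : 1 ≤ m) (hL : L ≤ c * n)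
    (h : Trained H σ αxy αyx β) (ε : ℝ) (P₁ P₂ : Fin n → Pauli) (ω : ℝ) (imag : Bool) :
    (correlationCircuit (m := m)
        (diagonalBlock Sum.inl (fun k => Sum.inr (Sum.inl k)) σ αxy αyx β ε)
        (controlledPauliSplit (Sum.inr (Sum.inr ())) (fun k => Sum.inr (Sum.inl k)) P₂)
        (controlledPauliSplit (Sum.inr (Sum.inr ())) (fun k => Sum.inr (Sum.inl k)) P₁)
        imag ω ε).Implements
      (correlationCircuit
        (evolutionBlock Sum.inl (fun k => Sum.inr (Sum.inl k)) H ε)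
        (controlledPauli (Sum.inr (Sum.inr ())) (fun k => Sum.inr (Sum.inl k)) P₂)
        (controlledPauli (Sum.inr (Sum.inr ())) (fun k => Sum.inr (Sum.inl k)) P₁)
        imag ω ε) ((16 * c + 30) * (m * n)) := by
  have hs : Function.Injective (fun k => Sum.inr (Sum.inl k) : Fin n → RegF m n) :=
    Sum.inr_injective.comp Sum.inl_injective
  have hc : ∀ (j : Fin m) (i : Fin n), (Sum.inr (Sum.inl i) : RegF m n) ≠ Sum.inl j :=
    fun _ _ => Sum.inr_ne_inl
  have ha : ∀ i : Fin n, (Sum.inr (Sum.inl i) : RegF m n) ≠ Sum.inr (Sum.inr ()) :=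
    fun _ => Sum.inr_injective.ne Sum.inl_ne_inr
  refine ⟨(((((((isElementary_hadamards _).append
      (isElementary_one _ hadamard_mem_unitaryGroup)).append ?_).append
      (isElementary_controlledPauliSplit ha _)).append
      (isElementary_diagonalBlock hs hc _ _ _ _ _)).append
      (isElementary_controlledPauliSplit ha _)).append
      (Circuit.isElementary_ofFn _ fun j => isElementary_controlled Sum.inr_ne_inl
        (site_mem_unitaryGroup (0 : Fin 1) (phaseGate_mem_unitaryGroup _)))).append
      (isElementary_one _ hadamard_mem_unitaryGroup), ?_,
    (((((((((delayLE_ofFn _).append (delayLE_length _)).append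
      (T' := 1) ?_).append (delayLE_ofFn _)).append
      (delayLE_diagonalBlock _ hs _ _ _ _ _)).append
      (delayLE_ofFn _)).append
      (delayLE_ofFn _)).append (delayLE_length _)).mono ?_).depth_le⟩
  · split_ifs
    · exact isElementary_one _ sDagger_mem_unitaryGroup
    · exact fun g hg => absurd hg List.not_mem_nil
  · simp only [correlationCircuit, Circuit.eval_append, eval_diagonalBlock hs hc h,
      eval_controlledPauliSplit hs ha]
  · split_ifs
    · exact delayLE_length _
    · exact (delayLE_length _).mono (Nat.zero_le 1)
  · have := diagonal_depth_bound hm hL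
    have := Nat.le_mul_of_pos_right m hn
    have := Nat.le_mul_of_pos_left n hm
    simp only [List.length_singleton]
    nlinarith

end Implementations

/-! ### Orthogonal matrices as products of plane rotations -/

section Rotations

variable {n : ℕ}

/-- The rotation by the angle `φ` in the plane of the coordinates `j` and `j'`. -/
noncomputable def planeRotation (j j' : Fin n) (φ : ℝ) : Matrix (Fin n) (Fin n) ℝ :=
  Matrix.of fun l k =>
    if k = j then (Pi.single j (Real.cos φ) - Pi.single j' (Real.sin φ) : Fin n → ℝ) l
    else if k = j' then (Pi.single j (Real.sin φ) + Pi.single j' (Real.cos φ) : Fin n → ℝ) l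
    else (Pi.single k 1 : Fin n → ℝ) l

theorem planeRotation_mulVec_first (j j' : Fin n) (φ : ℝ) :
    planeRotation j j' φ *ᵥ Pi.single j 1 =
      Pi.single j (Real.cos φ) - Pi.single j' (Real.sin φ) := by
  rw [Matrix.mulVec_single_one]
  funext l
  simp [planeRotation]

theorem planeRotation_mulVec_second {j j' : Fin n} (h : j ≠ j') (φ : ℝ) :
    planeRotation j j' φ *ᵥ Pi.single j' 1 =
      Pi.single j (Real.sin φ) + Pi.single j' (Real.cos φ) := by
  rw [Matrix.mulVec_single_one]
  funext l
  simp [planeRotation, h.symm]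

theorem planeRotation_mulVec_other {j j' k : Fin n} (h : k ≠ j) (h' : k ≠ j') (φ : ℝ) :
    planeRotation j j' φ *ᵥ Pi.single k 1 = Pi.single k 1 := by
  rw [Matrix.mulVec_single_one]
  funext l
  simp [planeRotation, h, h']

theorem planeRotation_zero {j j' : Fin n} : planeRotation j j' 0 = 1 := by
  ext l k
  simp only [planeRotation, Matrix.of_apply, Real.cos_zero, Real.sin_zero, Pi.single_zero, sub_zero,
    zero_add, Matrix.one_apply, Pi.single_apply]
  split_ifs <;> simp_all

theorem planeRotation_transpose {j j' : Fin n} (h : j ≠ j') (φ : ℝ) :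
    (planeRotation j j' φ)ᵀ = planeRotation j j' (-φ) := by
  ext l k
  simp only [planeRotation, Matrix.of_apply, Matrix.transpose_apply, Real.cos_neg, Real.sin_neg,
    Pi.sub_apply, Pi.add_apply, Pi.single_apply]
  split_ifs <;> grind

theorem matrix_ext_single {A B : Matrix (Fin n) (Fin n) ℝ}
    (h : ∀ k, A *ᵥ Pi.single k 1 = B *ᵥ Pi.single k 1) : A = B := by
  ext l k
  have := congrFun (h k) l
  simpa using this

theorem single_eq_smul (k : Fin n) (r : ℝ) :
    (Pi.single k r : Fin n → ℝ) = r • Pi.single k 1 := by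
  rw [← Pi.single_smul, smul_eq_mul, mul_one]

theorem planeRotation_mem_orthogonalGroup {j j' : Fin n} (h : j ≠ j') (φ : ℝ) :
    planeRotation j j' φ ∈ Matrix.orthogonalGroup (Fin n) ℝ := by
  rw [Matrix.mem_orthogonalGroup_iff, planeRotation_transpose h]
  have hsq := Real.sin_sq_add_cos_sq φ
  refine matrix_ext_single fun k => ?_
  rw [← Matrix.mulVec_mulVec, Matrix.one_mulVec]
  by_cases hj : k = j
  · subst hj
    rw [planeRotation_mulVec_first, Real.cos_neg, Real.sin_neg, Matrix.mulVec_sub,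
      single_eq_smul k, single_eq_smul j', Matrix.mulVec_smul, Matrix.mulVec_smul,
      planeRotation_mulVec_first, planeRotation_mulVec_second h, single_eq_smul k (Real.cos φ),
      single_eq_smul k (Real.sin φ), single_eq_smul j' (Real.sin φ),
      single_eq_smul j' (Real.cos φ)]
    calc _ = (Real.sin φ ^ 2 + Real.cos φ ^ 2) • (Pi.single k 1 : Fin n → ℝ) := by module
      _ = _ := by rw [hsq, one_smul]
  · by_cases hj' : k = j'
    · subst hj'
      rw [planeRotation_mulVec_second h, Real.cos_neg, Real.sin_neg, Matrix.mulVec_add,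
        single_eq_smul k, single_eq_smul j, Matrix.mulVec_smul, Matrix.mulVec_smul,
        planeRotation_mulVec_first, planeRotation_mulVec_second h, single_eq_smul k (Real.cos φ),
        single_eq_smul k (Real.sin φ), single_eq_smul j (Real.sin φ),
        single_eq_smul j (Real.cos φ)]
      calc _ = (Real.sin φ ^ 2 + Real.cos φ ^ 2) • (Pi.single k 1 : Fin n → ℝ) := by module
        _ = _ := by rw [hsq, one_smul]
    · rw [planeRotation_mulVec_other hj hj', planeRotation_mulVec_other hj hj']

/-- The rotation in the plane of the coordinates `j` and `j + 1`. -/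
noncomputable def stepRotation (n j : ℕ) (φ : ℝ) : Matrix (Fin n) (Fin n) ℝ :=
  if h : j < n - 1 then planeRotation (left ⟨j, h⟩) (right ⟨j, h⟩) φ else 1

/-- The product of the first `k` rotations of neighbouring coordinates. -/
noncomputable def ladder (n : ℕ) (θ : ℕ → ℝ) (k : ℕ) : Matrix (Fin n) (Fin n) ℝ :=
  ((List.range k).map fun j => stepRotation n j (θ j)).prod

theorem ladder_succ (θ : ℕ → ℝ) (k : ℕ) :
    ladder n θ (k + 1) = ladder n θ k * stepRotation n k (θ k) := by
  simp [ladder, List.range_succ]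

theorem ladder_congr {θ θ' : ℕ → ℝ} {k : ℕ} (h : ∀ j < k, θ j = θ' j) :
    ladder n θ k = ladder n θ' k := by
  rw [ladder, ladder]
  congr 1
  refine List.map_congr_left fun j hj => ?_
  rw [h j (List.mem_range.1 hj)]

theorem stepRotation_zero (j : ℕ) : stepRotation n j 0 = 1 := by
  rw [stepRotation]
  split_ifs
  · exact planeRotation_zero
  · rfl

/-- Makes a partial ladder an instance of a full layer of the ansatz. -/
theorem ladder_cutoff (θ : ℕ → ℝ) {k N : ℕ} (h : k ≤ N) :
    ladder n (fun j => if j < k then θ j else 0) N = ladder n θ k := by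
  induction N, h using Nat.le_induction with
  | base => exact ladder_congr fun j hj => if_pos hj
  | succ N hN ih => rw [ladder_succ, ih, if_neg (by omega), stepRotation_zero, mul_one]

theorem ladder_mem_orthogonalGroup (θ : ℕ → ℝ) (k : ℕ) :
    ladder n θ k ∈ Matrix.orthogonalGroup (Fin n) ℝ := by
  refine Submonoid.list_prod_mem _ fun A hA => ?_
  obtain ⟨j, -, rfl⟩ := List.mem_map.1 hA
  rw [stepRotation]
  split_ifs
  · exact planeRotation_mem_orthogonalGroup (left_ne_right _) _
  · exact one_mem _

/-- The first `k` rotations only mix the coordinates `0, …, k`. -/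
theorem ladder_mulVec_single (θ : ℕ → ℝ) {k : ℕ} {i : Fin n} (h : k < i) :
    ladder n θ k *ᵥ Pi.single i 1 = Pi.single i 1 := by
  induction k with
  | zero =>
    rw [ladder, List.range_zero, List.map_nil, List.prod_nil, Matrix.one_mulVec]
  | succ k ih =>
    rw [ladder_succ, ← Matrix.mulVec_mulVec]
    have : stepRotation n k (θ k) *ᵥ Pi.single i 1 = Pi.single i 1 := by
      rw [stepRotation]
      split_ifs
      · refine planeRotation_mulVec_other ?_ ?_ _ <;> intro h' <;> have := congrArg Fin.val h' <;>
          simp only [left, right] at this <;> omega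
      · exact Matrix.one_mulVec _
    rw [this, ih (by omega)]

/-- Spherical coordinates. -/
theorem exists_ladder_mulVec (k : ℕ) (hk : k < n) (v : Fin n → ℝ)
    (hv : ∀ i : Fin n, k < i → v i = 0) :
    ∃ (θ : ℕ → ℝ) (r : ℝ), ladder n θ k *ᵥ (r • Pi.single ⟨k, hk⟩ 1) = v := by
  induction k generalizing v with
  | zero =>
    refine ⟨fun _ => 0, v ⟨0, hk⟩, ?_⟩
    rw [ladder, List.range_zero, List.map_nil, List.prod_nil, Matrix.one_mulVec]
    funext i
    by_cases hi : i = ⟨0, hk⟩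
    · subst hi; simp
    · rw [hv i (Nat.pos_of_ne_zero fun h => hi (Fin.ext h))]
      simp [hi]
  | succ k ih =>
    let i₁ : Fin n := ⟨k + 1, hk⟩
    obtain ⟨θ, r, h⟩ := ih (by omega) (Function.update v i₁ 0) (by
      intro i hi
      by_cases hi' : i = i₁
      · rw [hi', Function.update_self]
      · rw [Function.update_of_ne hi']
        refine hv i (lt_of_le_of_ne hi fun h => hi' (Fin.ext h.symm)))
    -- The last angle is the polar angle of `(v i₁, r)`: the last rotation splits `‖z‖` into the
    -- coordinate `v i₁`, which the shorter ladder leaves alone, and the radius `r` that it needs.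
    let z : ℂ := ⟨v i₁, r⟩
    have hcos : ‖z‖ * Real.cos z.arg = v i₁ := Complex.norm_mul_cos_arg z
    have hsin : ‖z‖ * Real.sin z.arg = r := Complex.norm_mul_sin_arg z
    refine ⟨Function.update θ k z.arg, ‖z‖, ?_⟩
    have hstep : stepRotation n k z.arg *ᵥ Pi.single i₁ 1 =
        Real.sin z.arg • Pi.single ⟨k, by omega⟩ 1 + Real.cos z.arg • Pi.single i₁ 1 := by
      rw [stepRotation, dif_pos (by omega)]
      refine (planeRotation_mulVec_second (left_ne_right ⟨k, by omega⟩) _).trans ?_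
      rw [single_eq_smul _ (Real.sin _), single_eq_smul _ (Real.cos _)]
      rfl
    rw [ladder_succ, Function.update_self, ← Matrix.mulVec_mulVec, Matrix.mulVec_smul, hstep,
      smul_add, smul_smul, smul_smul, hcos, hsin, Matrix.mulVec_add,
      ladder_congr (θ' := θ) (fun j hj => Function.update_of_ne hj.ne _ _), h, Matrix.mulVec_smul,
      ladder_mulVec_single _ (by simp [i₁])]
    funext i
    by_cases hi : i = i₁
    · subst hi; simp
    · simp [hi]

theorem prod_ofFn_stepRotation (θ : Fin (n - 1) → ℝ) (θ' : ℕ → ℝ) (h : ∀ j, θ j = θ' j) :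
    (List.ofFn fun j => planeRotation (left j) (right j) (θ j)).prod = ladder n θ' (n - 1) := by
  have key : ∀ (g : ℕ → Matrix (Fin n) (Fin n) ℝ) (N : ℕ),
      List.ofFn (fun j : Fin N => g j) = (List.range N).map g := by
    intro g N
    refine List.ext_getElem (by simp) fun i _ _ => by simp
  rw [ladder, ← key]
  congr 2
  funext j
  rw [stepRotation, dif_pos j.2, h]

/-- Up to the signs of the columns, an orthogonal matrix is a product of `n` ladders. -/
theorem exists_ladders (k : ℕ) (hk : k ≤ n) (O : Matrix (Fin n) (Fin n) ℝ)
    (hO : O ∈ Matrix.orthogonalGroup (Fin n) ℝ)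
    (hfix : ∀ i : Fin n, k ≤ i → O *ᵥ Pi.single i 1 = Pi.single i 1) (L : ℕ) (hL : k ≤ L) :
    ∃ (θ : Fin L → Fin (n - 1) → ℝ) (s : Fin n → ℝ), (∀ i, s i * s i = 1) ∧
      (List.ofFn fun l => (List.ofFn fun j => planeRotation (left j) (right j) (θ l j)).prod).prod =
        O * Matrix.diagonal s := by
  induction k generalizing O L with
  | zero =>
    -- All basis vectors are fixed, so the matrix is `1`; surplus layers get zero angles.
    refine ⟨fun _ _ => 0, fun _ => 1, by simp, ?_⟩
    have : O = 1 := matrix_ext_single fun i => by rw [hfix i (Nat.zero_le _), Matrix.one_mulVec]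
    rw [this]
    simp [planeRotation_zero, List.ofFn_const]
  | succ k ih =>
    obtain ⟨L, rfl⟩ : ∃ L', L = L' + 1 := ⟨L - 1, by omega⟩
    let i₀ : Fin n := ⟨k, hk⟩
    have hO₁ := (Matrix.mem_orthogonalGroup_iff' _ _).1 hO
    have hdot : ∀ v w : Fin n → ℝ, (O *ᵥ v) ⬝ᵥ (O *ᵥ w) = v ⬝ᵥ w := by
      intro v w
      rw [Matrix.dotProduct_mulVec, ← Matrix.mulVec_transpose, Matrix.mulVec_mulVec, hO₁,
        Matrix.one_mulVec]
    -- Column `k` is orthogonal to the fixed vectors `e_i` with `i > k`, so its entries beyond `k`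
    -- vanish and a ladder of length `k` reaches it.
    obtain ⟨θ₀, r, hr⟩ := exists_ladder_mulVec k hk (O *ᵥ Pi.single i₀ 1) (by
      intro i hi
      have := hdot (Pi.single i 1) (Pi.single i₀ 1)
      rw [hfix i hi, single_dotProduct, single_dotProduct, one_mul, one_mul] at this
      rw [this, Pi.single_eq_of_ne]
      exact fun h => by simp [h, i₀] at hi)
    have hQ := ladder_mem_orthogonalGroup (n := n) θ₀ k
    set Q := ladder n θ₀ k with hQdef
    have hQ₁ := (Matrix.mem_orthogonalGroup_iff _ _).1 hQ
    have hQ₂ := (Matrix.mem_orthogonalGroup_iff' _ _).1 hQ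
    have hr₀ : Qᵀ *ᵥ (O *ᵥ Pi.single i₀ 1) = r • Pi.single i₀ 1 := by
      rw [← hr, Matrix.mulVec_mulVec, hQ₂, Matrix.one_mulVec]
    have hr₁ : r * r = 1 := by
      have h₁ := hdot (Pi.single i₀ 1) (Pi.single i₀ 1)
      rw [← hr, Matrix.dotProduct_mulVec, ← Matrix.mulVec_transpose, Matrix.mulVec_mulVec, hQ₂,
        Matrix.one_mulVec] at h₁
      simpa [i₀] using h₁
    -- By `hr₁` the radius is a sign. Flipping column `k` by it makes `Qᵀ * O * diagonal d` fix
    -- `e_k` as well, while the later basis vectors stay fixed; the induction applies to this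
    -- matrix.
    let d : Fin n → ℝ := Function.update 1 i₀ r
    have hd : ∀ i, d i * d i = 1 := by
      intro i
      by_cases hi : i = i₀
      · subst hi; simpa [d] using hr₁
      · simp [d, hi]
    have hdiag : Matrix.diagonal d ∈ Matrix.orthogonalGroup (Fin n) ℝ := by
      rw [Matrix.mem_orthogonalGroup_iff, Matrix.diagonal_transpose, Matrix.diagonal_mul_diagonal]
      simp only [hd, Matrix.diagonal_one]
    have hQt : Qᵀ ∈ Matrix.orthogonalGroup (Fin n) ℝ := by
      rw [Matrix.mem_orthogonalGroup_iff, Matrix.transpose_transpose, hQ₂]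
    have hdv : ∀ i : Fin n, Matrix.diagonal d *ᵥ Pi.single i 1 = d i • Pi.single i 1 := by
      intro i
      rw [Matrix.diagonal_mulVec_single, mul_one, single_eq_smul]
    obtain ⟨θ, s, hs, hθ⟩ := ih (by omega) (Qᵀ * O * Matrix.diagonal d)
      (mul_mem (mul_mem hQt hO) hdiag) (by
        intro i hi
        rw [← Matrix.mulVec_mulVec, hdv, Matrix.mulVec_smul, ← Matrix.mulVec_mulVec]
        by_cases hi₀ : i = i₀
        · rw [hi₀, hr₀, smul_smul]
          simp [d, hr₁]
        · have hki : k < i := lt_of_le_of_ne hi fun h => hi₀ (Fin.ext h.symm)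
          rw [hfix i hki]
          have : Q *ᵥ Pi.single i 1 = Pi.single i 1 := ladder_mulVec_single _ hki
          conv_lhs => rw [← this]
          rw [Matrix.mulVec_mulVec, hQ₂, Matrix.one_mulVec]
          simp [d, hi₀]) L (by omega)
    refine ⟨Fin.cons (fun j => if (j : ℕ) < k then θ₀ j else 0) θ, d * s, fun i => ?_, ?_⟩
    · rw [Pi.mul_apply, mul_mul_mul_comm, hd, hs, one_mul]
    · rw [List.ofFn_succ, List.prod_cons]
      simp only [Fin.cons_zero, Fin.cons_succ]
      rw [hθ, prod_ofFn_stepRotation _ (fun j => if j < k then θ₀ j else 0) (fun _ => rfl),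
        ladder_cutoff _ (by omega), ← hQdef, ← mul_assoc, ← mul_assoc, ← mul_assoc, hQ₁, one_mul,
        mul_assoc, Matrix.diagonal_mul_diagonal]
      rfl

/-- The singular value decomposition of a real square matrix. -/
theorem exists_singular_value_decomposition (M : Matrix (Fin n) (Fin n) ℝ) :
    ∃ (U V : Matrix (Fin n) (Fin n) ℝ) (β : Fin n → ℝ), U ∈ Matrix.orthogonalGroup (Fin n) ℝ ∧
      V ∈ Matrix.orthogonalGroup (Fin n) ℝ ∧ M = U * Matrix.diagonal β * Vᵀ := by
  have hM : (Mᵀ * M).IsHermitian := by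
    simpa using Matrix.isHermitian_conjTranspose_mul_self M
  -- Images under `M` of an orthonormal eigenbasis of `Mᵀ * M`: they are pairwise orthogonal, and
  -- their lengths are the singular values.
  let w : Fin n → EuclideanSpace ℝ (Fin n) := fun i =>
    WithLp.toLp 2 (M *ᵥ (hM.eigenvectorBasis i : Fin n → ℝ))
  have hw : ∀ i j, i ≠ j → inner ℝ (w i) (w j) = 0 := by
    intro i j hij
    have h : inner ℝ (hM.eigenvectorBasis j) (hM.eigenvectorBasis i) = 0 :=
      hM.eigenvectorBasis.orthonormal.2 hij.symm
    rw [EuclideanSpace.inner_eq_star_dotProduct] at h ⊢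
    simp only [star_trivial, w] at h ⊢
    rw [Matrix.dotProduct_mulVec, ← Matrix.mulVec_transpose, Matrix.mulVec_mulVec,
      hM.mulVec_eigenvectorBasis, smul_dotProduct, dotProduct_comm, h, smul_zero]
  have hv : Orthonormal ℝ (Set.domRestrict {i | w i ≠ 0} fun i => (‖w i‖⁻¹ : ℝ) • w i) := by
    constructor
    · rintro ⟨i, hi⟩
      exact norm_smul_inv_norm hi
    · rintro ⟨i, hi⟩ ⟨j, hj⟩ hij
      have hij : i ≠ j := fun h => hij (Subtype.ext h)
      change inner ℝ ((‖w i‖⁻¹ : ℝ) • w i) ((‖w j‖⁻¹ : ℝ) • w j) = 0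
      rw [inner_smul_left, inner_smul_right, hw i j hij, mul_zero, mul_zero]
  -- The nonzero images are normalized and completed to a basis. Where the image vanishes, so does
  -- the singular value, and any vector will do.
  obtain ⟨b, hb⟩ := hv.exists_orthonormalBasis_extension_of_card_eq (by simp)
  have hbw : ∀ i, ‖w i‖ • b i = w i := by
    intro i
    by_cases hi : w i = 0
    · rw [hi, norm_zero, zero_smul]
    · rw [hb i hi, smul_smul, mul_inv_cancel₀ (norm_ne_zero_iff.2 hi), one_smul]
  let U : Matrix (Fin n) (Fin n) ℝ := Matrix.of fun l i => b i l
  have hU : U ∈ Matrix.orthogonalGroup (Fin n) ℝ := by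
    rw [Matrix.mem_orthogonalGroup_iff']
    ext i j
    have h := (orthonormal_iff_ite.1 b.orthonormal) i j
    rw [EuclideanSpace.inner_eq_star_dotProduct, dotProduct_comm] at h
    rw [Matrix.one_apply, ← h]
    rfl
  have hV : (hM.eigenvectorUnitary : Matrix (Fin n) (Fin n) ℝ) ∈
      Matrix.orthogonalGroup (Fin n) ℝ := hM.eigenvectorUnitary.2
  refine ⟨U, hM.eigenvectorUnitary, fun i => ‖w i‖, hU, hV, ?_⟩
  have h : M * (hM.eigenvectorUnitary : Matrix (Fin n) (Fin n) ℝ) =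
      U * Matrix.diagonal fun i => ‖w i‖ := by
    ext l i
    have hl := congrArg (fun v : EuclideanSpace ℝ (Fin n) => v l) (hbw i)
    rw [Matrix.mul_diagonal, mul_comm]
    exact hl.symm
  rw [← h, mul_assoc, (Matrix.mem_orthogonalGroup_iff _ _).1 hV, mul_one]

end Rotations

/-! ### Majorana operators -/

section Majorana

variable {n L : ℕ}

theorem site_smul {Q : Type} [Fintype Q] [DecidableEq Q] (q : Q) (c : ℂ)
    (A : Matrix (Fin 2) (Fin 2) ℂ) : site q (c • A) = c • site q A := by
  ext x y
  simp only [site, Matrix.of_apply, Matrix.smul_apply]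
  split_ifs <;> simp

/-- The Jordan–Wigner string `Z ⊗ ⋯ ⊗ Z ⊗ A ⊗ 1 ⊗ ⋯ ⊗ 1` with `A` at the site `j`. -/
def jwString (A : Matrix (Fin 2) (Fin 2) ℂ) (j : Fin n) : Op (Fin n) :=
  tensor fun k => if k < j then sigmaZ else if k = j then A else 1

theorem jwString_mul_same (A B : Matrix (Fin 2) (Fin 2) ℂ) (j : Fin n) :
    jwString A j * jwString B j = site j (A * B) := by
  rw [jwString, jwString, ← tensor_mul, site_eq_tensor]
  congr 1
  funext k
  rcases lt_trichotomy k j with h | h | h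
  · simp [h, h.ne, sigmaZ_mul_self]
  · simp [h]
  · simp [h.ne', h.not_gt]

/-- The common `Z` strings cancel, which leaves neighbouring products local. -/
theorem jwString_mul_succ (A B : Matrix (Fin 2) (Fin 2) ℂ) (j : Fin (n - 1)) :
    jwString A (left j) * jwString B (right j) =
      site (left j) (A * sigmaZ) * site (right j) B := by
  have hlt : left j < right j := Nat.lt_succ_self _
  rw [jwString, jwString, ← tensor_mul, site_eq_tensor, site_eq_tensor, ← tensor_mul]
  congr 1
  funext k
  simp only [Pi.mul_apply]
  rcases lt_trichotomy k (left j) with h | h | h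
  · simp [h, h.trans hlt, h.ne, (h.trans hlt).ne, sigmaZ_mul_self]
  · simp [h, hlt, hlt.ne]
  · have h' : ¬ k < right j := not_lt.2 (Nat.succ_le_of_lt h)
    by_cases hk : k = right j
    · simp [hk, hlt.ne', hlt.not_gt]
    · simp [hk, h', h.not_gt, h.ne']

/-- The only sign comes from site `i`, where `A` meets a `Z` of the longer string; at every other
site the factors commute. -/
theorem jwString_anticomm_lt {A : Matrix (Fin 2) (Fin 2) ℂ} (hA : A * sigmaZ = -(sigmaZ * A))
    (B : Matrix (Fin 2) (Fin 2) ℂ) {i j : Fin n} (hij : i < j) :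
    jwString A i * jwString B j = -(jwString B j * jwString A i) := by
  rw [jwString, jwString, ← tensor_mul, ← tensor_mul, ← neg_one_smul ℂ]
  refine tensor_eq_smul i (-1) ?_ fun k hk => ?_
  · simp [hij, hA]
  · simp only [Pi.mul_apply]
    rcases lt_or_gt_of_ne hk with h | h
    · simp [h, h.trans hij]
    · simp [hk, h.not_gt]

theorem jwString_anticomm {A B : Matrix (Fin 2) (Fin 2) ℂ} (hA : A * sigmaZ = -(sigmaZ * A))
    (hB : B * sigmaZ = -(sigmaZ * B)) {i j : Fin n} (hij : i ≠ j) :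
    jwString A i * jwString B j = -(jwString B j * jwString A i) := by
  rcases lt_or_gt_of_ne hij with h | h
  · exact jwString_anticomm_lt hA B h
  · rw [jwString_anticomm_lt hB A h, neg_neg]

theorem sigmaX_mul_sigmaZ : sigmaX * sigmaZ = (-Complex.I) • sigmaY := by
  ext i j; fin_cases i <;> fin_cases j <;> simp [sigmaX, sigmaY, sigmaZ]

theorem sigmaY_mul_sigmaZ : sigmaY * sigmaZ = Complex.I • sigmaX := by
  ext i j; fin_cases i <;> fin_cases j <;> simp [sigmaX, sigmaY, sigmaZ]

theorem sigmaX_mul_sigmaY : sigmaX * sigmaY = Complex.I • sigmaZ := by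
  ext i j; fin_cases i <;> fin_cases j <;> simp [sigmaX, sigmaY, sigmaZ]

theorem sigmaX_anticomm_sigmaZ : sigmaX * sigmaZ = -(sigmaZ * sigmaX) := by
  ext i j; fin_cases i <;> fin_cases j <;> simp [sigmaX, sigmaZ]

theorem sigmaY_anticomm_sigmaZ : sigmaY * sigmaZ = -(sigmaZ * sigmaY) := by
  ext i j; fin_cases i <;> fin_cases j <;> simp [sigmaY, sigmaZ]

theorem sigmaX_anticomm_sigmaY : sigmaX * sigmaY = -(sigmaY * sigmaX) := by
  ext i j; fin_cases i <;> fin_cases j <;> simp [sigmaX, sigmaY]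

/-- The Majorana operators `Z ⋯ Z X`. -/
def majoranaA (j : Fin n) : Op (Fin n) := jwString sigmaX j

/-- The Majorana operators `Z ⋯ Z Y`. -/
def majoranaB (j : Fin n) : Op (Fin n) := jwString sigmaY j

theorem majoranaA_mul_self (j : Fin n) : majoranaA j * majoranaA j = 1 := by
  rw [majoranaA, jwString_mul_same, sigmaX_mul_self, site_one]

theorem majoranaB_mul_self (j : Fin n) : majoranaB j * majoranaB j = 1 := by
  rw [majoranaB, jwString_mul_same, sigmaY_mul_self, site_one]

theorem majoranaA_anticomm {i j : Fin n} (h : i ≠ j) :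
    majoranaA i * majoranaA j = -(majoranaA j * majoranaA i) :=
  jwString_anticomm sigmaX_anticomm_sigmaZ sigmaX_anticomm_sigmaZ h

theorem majoranaB_anticomm {i j : Fin n} (h : i ≠ j) :
    majoranaB i * majoranaB j = -(majoranaB j * majoranaB i) :=
  jwString_anticomm sigmaY_anticomm_sigmaZ sigmaY_anticomm_sigmaZ h

theorem majoranaA_majoranaB_anticomm (i j : Fin n) :
    majoranaA i * majoranaB j = -(majoranaB j * majoranaA i) := by
  by_cases h : i = j
  · rw [h, majoranaA, majoranaB, jwString_mul_same, jwString_mul_same, sigmaX_anticomm_sigmaY,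
      ← neg_one_smul ℂ, site_smul, neg_one_smul]
  · exact jwString_anticomm sigmaX_anticomm_sigmaZ sigmaY_anticomm_sigmaZ h

theorem site_sigmaZ_eq (j : Fin n) :
    site j sigmaZ = (-Complex.I) • (majoranaA j * majoranaB j) := by
  rw [majoranaA, majoranaB, jwString_mul_same, sigmaX_mul_sigmaY, site_smul, smul_smul]
  simp

theorem site_XX_eq (j : Fin (n - 1)) : site (left j) sigmaX * site (right j) sigmaX =
    -((-Complex.I) • (majoranaA (right j) * majoranaB (left j))) := by
  rw [majoranaA_majoranaB_anticomm, majoranaA, majoranaB, jwString_mul_succ, sigmaY_mul_sigmaZ,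
    site_smul, smul_mul_assoc, smul_neg, smul_smul]
  simp

theorem site_YY_eq (j : Fin (n - 1)) : site (left j) sigmaY * site (right j) sigmaY =
    -((-Complex.I) • (majoranaA (left j) * majoranaB (right j))) := by
  rw [majoranaA, majoranaB, jwString_mul_succ, sigmaX_mul_sigmaZ, site_smul, smul_mul_assoc,
    smul_smul]
  simp

/-- Unlike the terms of `H`, the generators of the ansatz do not mix the two kinds of Majorana
operators. -/
theorem site_XY_eq (j : Fin (n - 1)) : site (left j) sigmaX * site (right j) sigmaY =
    (-Complex.I) • (majoranaB (left j) * majoranaB (right j)) := by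
  rw [majoranaB, majoranaB, jwString_mul_succ, sigmaY_mul_sigmaZ, site_smul, smul_mul_assoc,
    smul_smul]
  simp

theorem site_YX_eq (j : Fin (n - 1)) : site (left j) sigmaY * site (right j) sigmaX =
    Complex.I • (majoranaA (left j) * majoranaA (right j)) := by
  rw [majoranaA, majoranaA, jwString_mul_succ, sigmaX_mul_sigmaZ, site_smul, smul_mul_assoc,
    smul_smul]
  simp

/-! ### Operators which rotate the Majorana operators -/

/-- Conjugation by `W` acts on the operators `γ` by the matrix `R`. -/
def Rotates (γ : Fin n → Op (Fin n)) (W : Op (Fin n)) (R : Matrix (Fin n) (Fin n) ℝ) : Prop :=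
  ∀ k, W * γ k = (∑ l, (R l k : ℂ) • γ l) * W

theorem Rotates.mul {γ : Fin n → Op (Fin n)} {W W' : Op (Fin n)}
    {R R' : Matrix (Fin n) (Fin n) ℝ} (h : Rotates γ W R) (h' : Rotates γ W' R') :
    Rotates γ (W * W') (R * R') := by
  intro k
  rw [mul_assoc, h', ← mul_assoc, ← mul_assoc]
  congr 1
  simp only [Finset.mul_sum, mul_smul_comm, h _, Finset.sum_mul, Finset.smul_sum, smul_mul_assoc,
    smul_smul, Matrix.mul_apply, Complex.ofReal_sum, Finset.sum_smul, Complex.ofReal_mul]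
  rw [Finset.sum_comm]
  simp only [mul_comm]

theorem rotates_of_commute {γ : Fin n → Op (Fin n)} {W : Op (Fin n)}
    (h : ∀ k, W * γ k = γ k * W) : Rotates γ W 1 := by
  intro k
  rw [h, Finset.sum_eq_single k]
  · simp
  · intro l _ hl
    simp [Matrix.one_apply_ne hl]
  · simp

theorem Rotates.list_prod {γ : Fin n → Op (Fin n)} {ι : Type} {W : ι → Op (Fin n)}
    {R : ι → Matrix (Fin n) (Fin n) ℝ} (h : ∀ i, Rotates γ (W i) (R i)) (l : List ι) :
    Rotates γ (l.map W).prod (l.map R).prod := by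
  induction l with
  | nil => exact rotates_of_commute fun k => by simp
  | cons i l ih =>
    rw [List.map_cons, List.prod_cons, List.map_cons, List.prod_cons]
    exact (h i).mul ih

theorem Rotates.list_prod_one {γ : Fin n → Op (Fin n)} {ι : Type} {W : ι → Op (Fin n)}
    (h : ∀ i, Rotates γ (W i) 1) (l : List ι) : Rotates γ (l.map W).prod 1 := by
  simpa using Rotates.list_prod h l

theorem sum_single_smul (γ : Fin n → Op (Fin n)) (j : Fin n) (c : ℝ) :
    ∑ l, (((Pi.single j c : Fin n → ℝ) l : ℝ) : ℂ) • γ l = (c : ℂ) • γ j := by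
  rw [Finset.sum_eq_single j]
  · simp
  · intro l _ hl
    simp [hl]
  · simp

/-- The exponential of a bilinear in anticommuting operators rotates them. -/
theorem rotates_bilinear {γ : Fin n → Op (Fin n)} (hγ : ∀ k, γ k * γ k = 1)
    (hγ' : ∀ i k, i ≠ k → γ i * γ k = -(γ k * γ i)) {j j' : Fin n} (h : j ≠ j') (θ : ℝ) :
    Rotates γ ((Real.cos θ : ℂ) • 1 + (Real.sin θ : ℂ) • (γ j * γ j'))
      (planeRotation j j' (2 * θ)) := by
  have e₁ : γ j * γ j' * γ j = -γ j' := by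
    rw [hγ' j j' h, neg_mul, mul_assoc, hγ, mul_one]
  have e₂ : γ j * γ j' * γ j' = γ j := by rw [mul_assoc, hγ, mul_one]
  have e₃ : γ j * (γ j * γ j') = γ j' := by rw [← mul_assoc, hγ, one_mul]
  have e₄ : γ j' * (γ j * γ j') = -γ j := by
    rw [← mul_assoc, hγ' j' j h.symm, neg_mul, mul_assoc, hγ, mul_one]
  have hsq : (Real.sin θ : ℂ) ^ 2 + (Real.cos θ : ℂ) ^ 2 = 1 := by
    exact_mod_cast Real.sin_sq_add_cos_sq θ
  have c₁ : ((Real.cos (2 * θ) : ℝ) : ℂ) = (Real.cos θ : ℂ) ^ 2 - (Real.sin θ : ℂ) ^ 2 := by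
    rw [Real.cos_two_mul']; push_cast; rfl
  have c₂ : ((Real.sin (2 * θ) : ℝ) : ℂ) = 2 * (Real.sin θ : ℂ) * (Real.cos θ : ℂ) := by
    rw [Real.sin_two_mul]; push_cast; rfl
  intro k
  by_cases hj : k = j
  · subst hj
    have hsum : ∑ l, ((planeRotation k j' (2 * θ) l k : ℝ) : ℂ) • γ l =
        (Real.cos (2 * θ) : ℂ) • γ k - (Real.sin (2 * θ) : ℂ) • γ j' := by
      rw [← sum_single_smul γ k, ← sum_single_smul γ j', ← Finset.sum_sub_distrib]
      refine Finset.sum_congr rfl fun l _ => ?_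
      rw [← sub_smul, ← Complex.ofReal_sub, planeRotation, Matrix.of_apply, if_pos rfl,
        Pi.sub_apply]
    rw [hsum, c₁, c₂]
    generalize (Real.cos θ : ℂ) = c at *
    generalize (Real.sin θ : ℂ) = s at *
    simp only [add_mul, mul_add, sub_mul, smul_mul_assoc, mul_smul_comm, one_mul, mul_one, e₁, e₃,
      e₄]
    -- The double-angle side is cubic in `c`, `s` and the other side linear; inserting `s ^ 2 + c ^
    -- 2 = 1` makes the degrees match.
    trans ((s ^ 2 + c ^ 2) * c) • γ k - ((s ^ 2 + c ^ 2) * s) • γ j'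
    · rw [hsq]; module
    · module
  by_cases hj' : k = j'
  · subst hj'
    have hsum : ∑ l, ((planeRotation j k (2 * θ) l k : ℝ) : ℂ) • γ l =
        (Real.sin (2 * θ) : ℂ) • γ j + (Real.cos (2 * θ) : ℂ) • γ k := by
      rw [← sum_single_smul γ k, ← sum_single_smul γ j, ← Finset.sum_add_distrib]
      refine Finset.sum_congr rfl fun l _ => ?_
      rw [← add_smul, ← Complex.ofReal_add, planeRotation, Matrix.of_apply, if_neg hj, if_pos rfl,
        Pi.add_apply]
    rw [hsum, c₁, c₂]
    generalize (Real.cos θ : ℂ) = c at *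
    generalize (Real.sin θ : ℂ) = s at *
    simp only [add_mul, mul_add, smul_mul_assoc, mul_smul_comm, one_mul, mul_one, e₂, e₃, e₄]
    trans ((s ^ 2 + c ^ 2) * c) • γ k + ((s ^ 2 + c ^ 2) * s) • γ j
    · rw [hsq]; module
    · module
  · have hsum : ∑ l, ((planeRotation j j' (2 * θ) l k : ℝ) : ℂ) • γ l = γ k := by
      rw [← one_smul ℂ (γ k), ← Complex.ofReal_one, ← sum_single_smul γ k]
      refine Finset.sum_congr rfl fun l _ => ?_
      rw [planeRotation, Matrix.of_apply, if_neg hj, if_neg hj']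
    have hk : γ j * γ j' * γ k = γ k * (γ j * γ j') := by
      rw [mul_assoc, hγ' j' k (Ne.symm hj'), mul_neg, ← mul_assoc, hγ' j k (Ne.symm hj), neg_mul,
        neg_neg, mul_assoc]
    rw [hsum, add_mul, mul_add, smul_mul_assoc, smul_mul_assoc, mul_smul_comm, mul_smul_comm, hk,
      one_mul, mul_one]

/-- Passing two anticommuting factors costs two signs. -/
theorem bilinear_commute {γ δ : Fin n → Op (Fin n)} (h : ∀ i k, γ i * δ k = -(δ k * γ i))
    (j j' : Fin n) (c s : ℂ) : Rotates δ (c • 1 + s • (γ j * γ j')) 1 := by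
  refine rotates_of_commute fun k => ?_
  have hk : γ j * γ j' * δ k = δ k * (γ j * γ j') := by
    rw [mul_assoc, h j' k, mul_neg, ← mul_assoc, h j k, neg_mul, neg_neg, mul_assoc]
  rw [add_mul, mul_add, smul_mul_assoc, smul_mul_assoc, mul_smul_comm, mul_smul_comm, hk,
    one_mul, mul_one]

theorem exp_XY_eq (j : Fin (n - 1)) (α : ℝ) :
    NormedSpace.exp ((Complex.I * α) • (site (left j) sigmaX * site (right j) sigmaY : Op (Fin n))) =
      (Real.cos α : ℂ) • 1 + (Real.sin α : ℂ) • (majoranaB (left j) * majoranaB (right j)) := by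
  rw [exp_involution _ (pair_mul_self (left_ne_right j) sigmaX_mul_self sigmaY_mul_self),
    site_XY_eq, smul_smul, Complex.ofReal_cos, Complex.ofReal_sin]
  congr 2
  linear_combination -Complex.sin α * Complex.I_mul_I

/-- The angle is reversed relative to `exp_XY_eq`, since the `a` bilinear enters with `i` and not
with `-i`. -/
theorem exp_YX_eq (j : Fin (n - 1)) (α : ℝ) :
    NormedSpace.exp ((Complex.I * α) • (site (left j) sigmaY * site (right j) sigmaX : Op (Fin n))) =
      (Real.cos (-α) : ℂ) • 1 +
        (Real.sin (-α) : ℂ) • (majoranaA (left j) * majoranaA (right j)) := by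
  rw [exp_involution _ (pair_mul_self (left_ne_right j) sigmaY_mul_self sigmaX_mul_self),
    site_YX_eq, smul_smul, Real.cos_neg, Real.sin_neg, Complex.ofReal_neg, Complex.ofReal_cos,
    Complex.ofReal_sin]
  congr 2
  linear_combination Complex.sin α * Complex.I_mul_I

/-- In every layer one half moves only the `b` and the other only the `a`, so the two ladders can be
chosen independently. -/
theorem rotates_ansatz (αxy αyx : Fin L → Fin (n - 1) → ℝ) :
    Rotates majoranaA (ansatz 1 αxy αyx) (List.ofFn fun l => (List.ofFn fun j =>
        planeRotation (left j) (right j) (2 * -αyx l j)).prod).prod ∧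
      Rotates majoranaB (ansatz 1 αxy αyx) (List.ofFn fun l => (List.ofFn fun j =>
        planeRotation (left j) (right j) (2 * αxy l j)).prod).prod := by
  have hBA : ∀ i k : Fin n, majoranaB i * majoranaA k = -(majoranaA k * majoranaB i) :=
    fun i k => by rw [majoranaA_majoranaB_anticomm, neg_neg]
  simp only [ansatz, List.ofFn_eq_map, Equiv.Perm.coe_one, id_eq, exp_XY_eq, exp_YX_eq]
  constructor <;> refine Rotates.list_prod (fun l => ?_) _
  · have h := (Rotates.list_prod_one (fun j => bilinear_commute hBA (left j) (right j)
      (Real.cos (αxy l j)) (Real.sin (αxy l j))) (List.finRange (n - 1))).mul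
        (Rotates.list_prod (fun j => rotates_bilinear majoranaA_mul_self
          (fun i k => majoranaA_anticomm) (left_ne_right j) (-αyx l j)) (List.finRange (n - 1)))
    rwa [one_mul] at h
  · have h := (Rotates.list_prod (fun j => rotates_bilinear majoranaB_mul_self
        (fun i k => majoranaB_anticomm) (left_ne_right j) (αxy l j)) (List.finRange (n - 1))).mul
      (Rotates.list_prod_one (fun j => bilinear_commute majoranaA_majoranaB_anticomm (left j)
        (right j) (Real.cos (-αyx l j)) (Real.sin (-αyx l j))) (List.finRange (n - 1)))
    rwa [mul_one] at h

/-! ### Quadratic Hamiltonians -/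

/-- The operator `-i ∑ M l p a l b p`. -/
noncomputable def quadratic (M : Matrix (Fin n) (Fin n) ℝ) : Op (Fin n) :=
  ∑ l, ∑ p, (M l p : ℂ) • ((-Complex.I) • (majoranaA l * majoranaB p))

theorem quadratic_add (M M' : Matrix (Fin n) (Fin n) ℝ) :
    quadratic (M + M') = quadratic M + quadratic M' := by
  simp only [quadratic, Matrix.add_apply, Complex.ofReal_add, add_smul, Finset.sum_add_distrib]

theorem quadratic_sum {ι : Type} (s : Finset ι) (M : ι → Matrix (Fin n) (Fin n) ℝ) :
    quadratic (∑ i ∈ s, M i) = ∑ i ∈ s, quadratic (M i) := by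
  have h0 : quadratic (0 : Matrix (Fin n) (Fin n) ℝ) = 0 := by simp [quadratic]
  exact map_sum (⟨⟨quadratic, h0⟩, quadratic_add⟩ : Matrix (Fin n) (Fin n) ℝ →+ Op (Fin n)) M s

theorem quadratic_single (l p : Fin n) (c : ℝ) : quadratic (Matrix.single l p c) =
    (c : ℂ) • ((-Complex.I) • (majoranaA l * majoranaB p)) := by
  rw [quadratic, Finset.sum_eq_single l, Finset.sum_eq_single p]
  · rw [Matrix.single_apply_same]
  · intro p' _ h
    rw [Matrix.single_apply_of_ne _ _ _ _ _ (by simp [h.symm]), Complex.ofReal_zero, zero_smul]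
  · simp
  · intro l' _ h
    refine Finset.sum_eq_zero fun p' _ => ?_
    rw [Matrix.single_apply_of_ne _ _ _ _ _ (by simp [h.symm]), Complex.ofReal_zero, zero_smul]
  · simp

theorem sum_comm_pairs {ι M : Type} [Fintype ι] [AddCommMonoid M] (f : ι → ι → ι → ι → M) :
    ∑ l, ∑ p, ∑ q, ∑ r, f l p q r = ∑ q, ∑ r, ∑ p, ∑ l, f l p q r :=
  calc ∑ l, ∑ p, ∑ q, ∑ r, f l p q r = ∑ p, ∑ l, ∑ q, ∑ r, f l p q r := Finset.sum_comm
    _ = ∑ p, ∑ q, ∑ l, ∑ r, f l p q r := Finset.sum_congr rfl fun _ _ => Finset.sum_comm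
    _ = ∑ q, ∑ p, ∑ l, ∑ r, f l p q r := Finset.sum_comm
    _ = ∑ q, ∑ p, ∑ r, ∑ l, f l p q r :=
      Finset.sum_congr rfl fun _ _ => Finset.sum_congr rfl fun _ _ => Finset.sum_comm
    _ = ∑ q, ∑ r, ∑ p, ∑ l, f l p q r := Finset.sum_congr rfl fun _ _ => Finset.sum_comm

/-- Conjugation acts on the coefficients by independent left and right factors, which is the form of
a singular value decomposition. -/
theorem quadratic_rotate {W : Op (Fin n)} {R S : Matrix (Fin n) (Fin n) ℝ}
    (hA : Rotates majoranaA W R) (hB : Rotates majoranaB W S) (M : Matrix (Fin n) (Fin n) ℝ) :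
    W * quadratic M = quadratic (R * M * Sᵀ) * W := by
  have h : ∀ l p, W * (majoranaA l * majoranaB p) =
      (∑ q, ∑ r, ((R q l * S r p : ℝ) : ℂ) • (majoranaA q * majoranaB r)) * W := by
    intro l p
    rw [← mul_assoc, hA, mul_assoc, hB, ← mul_assoc, Finset.sum_mul_sum]
    simp only [smul_mul_smul_comm, Complex.ofReal_mul]
  simp only [quadratic, Finset.mul_sum, mul_smul_comm, h, Finset.sum_mul, smul_mul_assoc,
    Matrix.mul_apply, Matrix.transpose_apply, Complex.ofReal_sum, Finset.sum_smul, Finset.smul_sum,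
    smul_smul, Complex.ofReal_mul]
  rw [sum_comm_pairs]
  refine Finset.sum_congr rfl fun q _ => Finset.sum_congr rfl fun r _ =>
    Finset.sum_congr rfl fun p _ => Finset.sum_congr rfl fun l _ => ?_
  congr 1
  ring

theorem diagAnsatz_eq_quadratic (β : Fin n → ℝ) :
    diagAnsatz β = quadratic (Matrix.diagonal β) := by
  rw [diagAnsatz, ← Matrix.sum_single_eq_diagonal, quadratic_sum]
  simp only [quadratic_single, site_sigmaZ_eq]

theorem xyHamiltonian_eq_quadratic (ax ay : Fin (n - 1) → ℝ) (az : Fin n → ℝ) :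
    xyHamiltonian ax ay az = quadratic
      ((∑ j, (Matrix.single (right j) (left j) (-ax j) +
        Matrix.single (left j) (right j) (-ay j))) + ∑ j, Matrix.single j j (az j)) := by
  simp only [xyHamiltonian, quadratic_add, quadratic_sum, quadratic_single, site_sigmaZ_eq,
    site_XX_eq, site_YY_eq, smul_neg, Complex.ofReal_neg, neg_smul]

/-- The ansatz with at least `n` layers diagonalizes every `XY` Hamiltonian. -/
theorem exists_trained (ax ay : Fin (n - 1) → ℝ) (az : Fin n → ℝ) (hL : n ≤ L) :
    ∃ (αxy αyx : Fin L → Fin (n - 1) → ℝ) (β : Fin n → ℝ),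
      Trained (xyHamiltonian ax ay az) 1 αxy αyx β := by
  rw [xyHamiltonian_eq_quadratic]
  obtain ⟨U, V, β, hU, hV, hM⟩ := exists_singular_value_decomposition
    ((∑ j, (Matrix.single (right j) (left j) (-ax j) +
        Matrix.single (left j) (right j) (-ay j))) + ∑ j, Matrix.single j j (az j))
  -- With `k = n` no basis vector is required to be fixed.
  obtain ⟨θ, s, hs, hθ⟩ := exists_ladders n le_rfl U hU (fun i hi => absurd i.2 (by omega)) L hL
  obtain ⟨θ', s', hs', hθ'⟩ := exists_ladders n le_rfl V hV (fun i hi => absurd i.2 (by omega)) L hL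
  -- Angles are halved because conjugation doubles them, and the minus sign undoes that of
  -- `exp_YX_eq`. The column signs `s`, `s'` of the two ladder products are absorbed in the
  -- diagonal.
  refine ⟨fun l j => θ' l j / 2, fun l j => -(θ l j / 2), fun k => s k * β k * s' k, ?_⟩
  obtain ⟨hA, hB⟩ := rotates_ansatz (fun l j => θ' l j / 2) (fun l j => -(θ l j / 2))
  simp only [neg_neg, mul_div_cancel₀ _ (two_ne_zero' ℝ), hθ, hθ'] at hA hB
  have hW := Matrix.mem_unitaryGroup_iff.1
    (ansatz_mem_unitaryGroup 1 (fun l j => θ' l j / 2) (fun l j => -(θ l j / 2)))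
  rw [Matrix.star_eq_conjTranspose] at hW
  rw [Trained, cost_eq_zero_iff, diagAnsatz_eq_quadratic, quadratic_rotate hA hB, mul_assoc, hW,
    mul_one, hM]
  congr 1
  rw [Matrix.transpose_mul, Matrix.diagonal_transpose, mul_assoc U (Matrix.diagonal s),
    Matrix.diagonal_mul_diagonal, ← mul_assoc, mul_assoc U _ (Matrix.diagonal s'),
    Matrix.diagonal_mul_diagonal]
  congr 3
  funext k
  linear_combination -β k * hs k - s k * s k * β k * hs' k

end Majorana

end HistoryCircuits

theorem mainTheorem11 :
    (∀ (n : ℕ) (ax ay : Fin (n - 1) → ℝ) (az : Fin n → ℝ) (L : ℕ), n ≤ L →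
      ∃ (αxy αyx : Fin L → Fin (n - 1) → ℝ) (β : Fin n → ℝ),
        Trained (xyHamiltonian ax ay az) 1 αxy αyx β) ∧
    (∀ c : ℕ, ∃ K : ℕ, ∀ (n m : ℕ), 1 ≤ n → 1 ≤ m →
      ∀ (ax ay : Fin (n - 1) → ℝ) (az : Fin n → ℝ) (L : ℕ), L ≤ c * n →
      ∀ (σ : Equiv.Perm (Fin (n - 1))) (αxy αyx : Fin L → Fin (n - 1) → ℝ) (β : Fin n → ℝ),
        Trained (xyHamiltonian ax ay az) σ αxy αyx β →
      ∀ (T ε : ℝ), ε = T / 2 ^ m →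
        ((historyCircuit (m := m) (diagonalBlock Sum.inl Sum.inr σ αxy αyx β ε)).Implements
            (historyCircuit
              (evolutionBlock Sum.inl Sum.inr (xyHamiltonian ax ay az) ε)) (K * (m * n)) ∧
          ∀ ψ₀ : (Fin n → Fin 2) → ℂ,
            (historyCircuit (m := m) (diagonalBlock Sum.inl Sum.inr σ αxy αyx β ε)).eval *ᵥ
              initialState ψ₀ = historyState (xyHamiltonian ax ay az) ε ψ₀) ∧
        (∀ (P₁ P₂ : Fin n → Pauli) (ω : ℝ) (imag : Bool),
          (correlationCircuit (m := m)
              (diagonalBlock Sum.inl (fun k => Sum.inr (Sum.inl k)) σ αxy αyx β ε)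
              (controlledPauliSplit (Sum.inr (Sum.inr ())) (fun k => Sum.inr (Sum.inl k)) P₂)
              (controlledPauliSplit (Sum.inr (Sum.inr ())) (fun k => Sum.inr (Sum.inl k)) P₁)
              imag ω ε).Implements
            (correlationCircuit
              (evolutionBlock Sum.inl (fun k => Sum.inr (Sum.inl k)) (xyHamiltonian ax ay az) ε)
              (controlledPauli (Sum.inr (Sum.inr ())) (fun k => Sum.inr (Sum.inl k)) P₂)
              (controlledPauli (Sum.inr (Sum.inr ())) (fun k => Sum.inr (Sum.inl k)) P₁)
              imag ω ε) (K * (m * n))) ∧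
        (loschmidtCircuit (m := m)
            (diagonalBlock Sum.inl (fun k => Sum.inr (Sum.inl k)) σ αxy αyx β ε)).Implements
          (loschmidtCircuit
            (evolutionBlock Sum.inl (fun k => Sum.inr (Sum.inl k)) (xyHamiltonian ax ay az) ε))
          (K * (m * n)) ∧
        (entropyOverlapCircuit (m := m)
            (diagonalBlock (fun j => Sum.inl (Sum.inl j)) (fun k => Sum.inl (Sum.inr k))
              σ αxy αyx β ε)
            (diagonalBlock (fun j => Sum.inr (Sum.inl j)) (fun k => Sum.inr (Sum.inr k))
              σ αxy αyx β ε)).Implements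
          (entropyOverlapCircuit
            (evolutionBlock (fun j => Sum.inl (Sum.inl j)) (fun k => Sum.inl (Sum.inr k))
              (xyHamiltonian ax ay az) ε)
            (evolutionBlock (fun j => Sum.inr (Sum.inl j)) (fun k => Sum.inr (Sum.inr k))
              (xyHamiltonian ax ay az) ε)) (K * (m * n)) ∧
        (∀ u : Fin m → Matrix.unitaryGroup (Fin 2) ℂ,
          (entropyRandomCircuit (diagonalBlock Sum.inl Sum.inr σ αxy αyx β ε) u).Implements
            (entropyRandomCircuit
              (evolutionBlock Sum.inl Sum.inr (xyHamiltonian ax ay az) ε) u) (K * (m * n)))) := by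
  refine ⟨fun n ax ay az L hL => exists_trained ax ay az hL, fun c => ⟨16 * c + 30, ?_⟩⟩
  intro n m hn hm ax ay az L hL σ αxy αyx β h T ε _
  have hist := historyCircuit_implements hn hm hL h ε
  refine ⟨⟨hist, fun ψ₀ => ?_⟩, correlationCircuit_implements hn hm hL h ε,
    loschmidtCircuit_implements hn hm hL h ε, entropyOverlapCircuit_implements hn hm hL h ε,
    entropyRandomCircuit_implements hn hm hL h ε⟩
  rw [hist.2.1, eval_historyCircuit_mulVec]
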